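/- Let $1\le k<N$ be integers and let $w=(w_0,\dots,w_{N-1})$ be a vector of positive weights. Equip the space of complex $N\times N$ matrices with the weighted Frobenius norm $\|A\|^2=\sum_{j,l=0}^{N-1} w_j|A(j,l)|^2w_l$. Let $\mathcal{R}_{N,k}$ be the set of matrices of rank at most $k$, $\mathcal{H}_N$ the space of Hankel matrices $Hf=(f_{j+l})_{j,l=0}^{N-1}$, $f=(f_m)_{m=0}^{2N-2}\in\mathbb{C}^{2N-1}$, and $\mathcal{H}_{N,k}=\mathcal{R}_{N,k}\cap\mathcal{H}_N$. Let $\mathcal{H}^n_{N,k}$ be the set of $Hf\in\mathcal{H}_{N,k}$ whose upper left $k\times k$ submatrix is non-singular and for which the polynomial $x^k+\sum_{l<k}\lambda_lx^l$ determined by the recursion $f_{j+k}+\sum_{l<k}\lambda_lf_{j+l}=0$ $(0\le j\le 2N-2-k)$ has only simple, non-zero roots; $\mathcal{H}^n_{N,k}$ is a manifold (of real dimension $4k$). A set is called thin if it is contained in a finite union of (embedded smooth) manifolds of dimension lower than that of $\mathcal{H}^n_{N,k}$. For a set $S$ of matrices, $P_S(B)$ denotes the point of $S$ closest to $B$; it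 is well defined if there is exactly one such point. There is a thin subset $T$ of $\mathcal{H}_{N,k}$ such that for every $A\in\mathcal{H}_{N,k}\setminus T$ and every $\epsilon>0$ there is an $s>0$ such that the following holds for all $f$ with $\|Hf-A\|\le s$. The sequence of alternating projections $$B_0=Hf,\qquad B_{j+1}=\begin{cases}P_{\mathcal{R}_{N,k}}(B_j), & j\text{ even},\\ P_{\mathcal{H}_N}(B_j), & j \text{ odd},\end{cases}$$ and the best approximation $Hf_{opt}=P_{\mathcal{H}_{N,k}}(Hf)$ are well defined, and (i) $(B_j)$ converges to a point $Hf_\infty\in\mathcal{H}^n_{N,k}$; (ii) $\|Hf_\infty-Hf_{opt}\|\le\epsilon\,\|Hf-Hf_{opt}\|$. -/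

import Mathlib

open Filter Topology Polynomial
open scoped ContDiff

/-- `M` is an embedded smooth (`C^∞`) submanifold, without boundary, of real dimension `d` of the
finite-dimensional real vector space `V`: near each of its points it is the zero set of a smooth
map to `ℝ^c`, `d + c = dim V`, whose derivative at that point is onto. -/
def IsSubmanifold {V : Type*} [NormedAddCommGroup V] [NormedSpace ℝ V] [FiniteDimensional ℝ V]
    (d : ℕ) (M : Set V) : Prop :=
  ∃ c : ℕ, d + c = Module.finrank ℝ V ∧
    ∀ x ∈ M, ∃ (U : Set V) (g : V → (Fin c → ℝ)), IsOpen U ∧ x ∈ U ∧ ContDiffOn ℝ ∞ g U ∧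
      Function.Surjective (fderiv ℝ g x) ∧ M ∩ U = {y ∈ U | g y = 0}

/-- `E` is thin relatively to the manifold `M`: it is contained in the union of finitely many
manifolds of dimension lower than the dimension of `M`. -/
def IsThinRelativeTo {V : Type*} [NormedAddCommGroup V] [NormedSpace ℝ V] [FiniteDimensional ℝ V]
    (E M : Set V) : Prop :=
  ∃ D : ℕ, IsSubmanifold D M ∧
    ∃ (n : ℕ) (S : Fin n → Set V), (∀ i, ∃ d < D, IsSubmanifold d (S i)) ∧ E ⊆ ⋃ i, S i

-- The Frobenius norm makes the space of complex matrices a normed space.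
attribute [local instance] Matrix.frobeniusNormedAddCommGroup Matrix.frobeniusNormedSpace

/-- The Hankel matrix generated by `f`, with entries `f (j + l)`, `0 ≤ j, l ≤ N - 1`. -/
def hankel {N : ℕ} (f : Fin (2 * N - 1) → ℂ) : Matrix (Fin N) (Fin N) ℂ :=
  Matrix.of fun j l => f ⟨j.1 + l.1, by omega⟩

/-- The set `𝓗_N` of `N × N` Hankel matrices. -/
def hankelSet (N : ℕ) : Set (Matrix (Fin N) (Fin N) ℂ) :=
  {A | ∀ j l j' l' : Fin N, j.1 + l.1 = j'.1 + l'.1 → A j l = A j' l'}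

/-- The set `𝓡_{N,k}` of `N × N` matrices of rank at most `k`. -/
def rankSet (N k : ℕ) : Set (Matrix (Fin N) (Fin N) ℂ) :=
  {A | A.rank ≤ k}

/-- `P` is the monic polynomial `x^r + ∑_{l < r} λ_l x^l` whose coefficients give the recursion
`f (j + r) + ∑_{l < r} λ_l f (j + l) = 0` satisfied by the whole finite sequence `f`. -/
def IsCentralPolynomial {N : ℕ} (r : ℕ) (f : Fin (2 * N - 1) → ℂ) (P : ℂ[X]) : Prop :=
  P.Monic ∧ P.natDegree = r ∧
    ∀ (j : ℕ) (hj : j + r < 2 * N - 1),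
      ∑ l : Fin (r + 1), P.coeff l.1 * f ⟨j + l.1, by omega⟩ = 0

/-- The class `𝓗ⁿ_{N,r}`, `r < N`: Hankel matrices of rank at most `r` whose upper left corner
submatrix of order `r` is non-singular and whose central polynomial has only simple, non-zero
roots. -/
def genericHankelSet {N r : ℕ} (hr : r < N) : Set (Matrix (Fin N) (Fin N) ℂ) :=
  {A | A ∈ rankSet N r ∩ hankelSet N ∧
    (A.submatrix (Fin.castLE hr.le) (Fin.castLE hr.le)).det ≠ 0 ∧
    ∃ (f : Fin (2 * N - 1) → ℂ) (P : ℂ[X]), A = hankel f ∧ IsCentralPolynomial r f P ∧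
      ¬ P.IsRoot 0 ∧ P.roots.Nodup}

/-- The weighted Frobenius norm `‖A‖_w`. -/
noncomputable def weightedNorm {N : ℕ} (w : Fin N → ℝ) (A : Matrix (Fin N) (Fin N) ℂ) : ℝ :=
  Real.sqrt (∑ j, ∑ l, w j * ‖A j l‖ ^ 2 * w l)

/-- The projection onto `S` is well defined at `B`, with value `P`: the point `P` is the unique
point of `S` closest to `B` with respect to `‖·‖_w`. -/
def IsProjection {N : ℕ} (w : Fin N → ℝ) (S : Set (Matrix (Fin N) (Fin N) ℂ))
    (B P : Matrix (Fin N) (Fin N) ℂ) : Prop :=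
  P ∈ S ∧ ∀ Q ∈ S, Q ≠ P → weightedNorm w (B - P) < weightedNorm w (B - Q)

/-- `B` is the sequence of alternating projections that starts at `B₀`: first onto `𝓡_{N,k}`,
then onto `𝓗_N`, and so on, all projections being well defined. -/
def IsAlternatingProjectionSeq {N : ℕ} (w : Fin N → ℝ) (k : ℕ)
    (B₀ : Matrix (Fin N) (Fin N) ℂ) (B : ℕ → Matrix (Fin N) (Fin N) ℂ) : Prop :=
  B 0 = B₀ ∧ ∀ j,
    (Even j → IsProjection w (rankSet N k) (B j) (B (j + 1))) ∧
    (Odd j → IsProjection w (hankelSet N) (B j) (B (j + 1)))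

/-!
After rescaling the entries the weighted norm is Euclidean, and the statement becomes one about
alternating projections between a closed set `R` and a subspace `L` near a point `a` of `R ∩ L`.
Suppose that near `a` both `R` and `R ∩ L` are ranges of `C²` retractions, and that a tangent vector
to `R` lying in `L` is tangent to `R ∩ L`. Then the angle between `R` and `L` transversally to
`R ∩ L` is positive, so a step of the algorithm contracts the distance to `R ∩ L` by a fixed factor
`κ < 1`, while it moves the nearest point of `R ∩ L` only by `o(1)` times that distance. Summing the
geometric series, the limit differs from the nearest point of `R ∩ L` by at most `ε` times the
initial distance.

For Hankel matrices of rank at most `k` with non-singular leading block of order `k`, the retraction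
onto the matrices of rank at most `k` is the skeleton decomposition, whose derivative at an entry
outside the leading rows and columns depends only on smaller antidiagonals. Hence a Hankel tangent
vector is determined by its first `2k` antidiagonals, which are coordinates on the Hankel matrices
of rank at most `k`.

The exceptional set is thin: if `s ≤ k` is the largest order up to `k` of a non-singular leading
block, then the first `2s` antidiagonals determine a recursion of length `s`, which by the bound on
the rank can fail only on the last `k - s` antidiagonals. Hence the matrix lies in a manifold of
real dimension `2(k + s)`, which is less than `4k` for `s < k`. For `s = k`, the failure of
genericity is the vanishing of a polynomial in the `2k` coordinates, which is not zero because the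
polynomial `X ^ k - 1` has simple, non-zero roots, and the zeros of a non-zero polynomial are
covered by finitely many manifolds of smaller dimension.
-/

section Nearest

variable {E : Type*} [NormedAddCommGroup E] {S : Set E} {a b p : E}

/-- `p` is a point of `S` closest to `b`. -/
def IsNearest (S : Set E) (b p : E) : Prop :=
  p ∈ S ∧ ∀ y ∈ S, ‖b - p‖ ≤ ‖b - y‖

/-- `p` is the only point of `S` closest to `b`, that is, the projection of `b` onto `S` is well
defined and equal to `p`. -/
def IsUniqueNearest (S : Set E) (b p : E) : Prop :=
  p ∈ S ∧ ∀ y ∈ S, y ≠ p → ‖b - p‖ < ‖b - y‖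

theorem IsNearest.isUniqueNearest (h : IsNearest S b p)
    (huniq : ∀ x y, IsNearest S b x → IsNearest S b y → x = y) : IsUniqueNearest S b p := by
  refine ⟨h.1, fun y hy hne => lt_of_le_of_ne (h.2 y hy) fun heq => hne ?_⟩
  exact huniq y p ⟨hy, fun z hz => heq ▸ h.2 z hz⟩ h

theorem IsNearest.norm_sub_le (h : IsNearest S b p) (ha : a ∈ S) : ‖p - a‖ ≤ 2 * ‖b - a‖ :=
  calc ‖p - a‖ = ‖(b - a) - (b - p)‖ := by congr 1; abel
    _ ≤ ‖b - a‖ + ‖b - p‖ := _root_.norm_sub_le _ _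
    _ ≤ 2 * ‖b - a‖ := by linarith [h.2 a ha]

theorem IsNearest.mul_dist_add_dist_le (h : IsNearest S b p) (ha : a ∈ S) {ε : ℝ} (hε : 0 ≤ ε) :
    (1 + ε) * dist b p + dist p a ≤ (ε + 3) * dist b a := by
  simp only [dist_eq_norm]
  calc (1 + ε) * ‖b - p‖ + ‖p - a‖ ≤ (1 + ε) * ‖b - a‖ + 2 * ‖b - a‖ := by
        gcongr
        exacts [h.2 a ha, h.norm_sub_le ha]
    _ = (ε + 3) * ‖b - a‖ := by ring

theorem tendsto_isNearest {β q : ℕ → E} (ha : a ∈ S) (hq : ∀ j, IsNearest S (β j) (q j))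
    (hβ : Tendsto β atTop (𝓝 a)) : Tendsto q atTop (𝓝 a) := by
  rw [tendsto_iff_norm_sub_tendsto_zero] at hβ ⊢
  exact squeeze_zero (fun _ => norm_nonneg _) (fun j => (hq j).norm_sub_le ha)
    (by simpa using hβ.const_mul 2)

theorem exists_isNearest [ProperSpace E] (hS : IsClosed S) (hne : S.Nonempty) (b : E) :
    ∃ p, IsNearest S b p := by
  obtain ⟨p, hp, hdist⟩ := hS.exists_infDist_eq_dist hne b
  refine ⟨p, hp, fun y hy => ?_⟩
  rw [← dist_eq_norm, ← dist_eq_norm, ← hdist]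
  exact Metric.infDist_le_dist_of_mem hy

theorem eventually_forall_isNearest (ha : a ∈ S) {Q : E → Prop} (hQ : ∀ᶠ x in 𝓝 a, Q x) :
    ∀ᶠ b in 𝓝 a, ∀ p, IsNearest S b p → Q p := by
  obtain ⟨ρ, hρ, hball⟩ := Metric.eventually_nhds_iff_ball.1 hQ
  filter_upwards [Metric.ball_mem_nhds a (half_pos hρ)] with b hb p hp
  rw [mem_ball_iff_norm] at hb
  exact hball p (by rw [mem_ball_iff_norm]; linarith [hp.norm_sub_le ha])

end Nearest

section LocalRetraction

variable {V W : Type*} [NormedAddCommGroup V] [NormedSpace ℝ V] [NormedAddCommGroup W]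
  [NormedSpace ℝ W] {r r' : V → V} {S S' : Set V} {a : V}

/-- `r` is a `C²` retraction onto `S` near the point `a`. All the regularity of `S` at `a` that the
convergence analysis needs is carried by such a map: it is obtained from an explicit formula, both
for the set of matrices of bounded rank and for its intersection with the Hankel matrices. -/
structure IsLocalRetraction (r : V → V) (S : Set V) (a : V) : Prop where
  contDiffAt : ContDiffAt ℝ 2 r a
  mem : ∀ᶠ x in 𝓝 a, r x ∈ S
  fix : ∀ᶠ x in 𝓝 a, x ∈ S → r x = x

/-- The tangent space at `a` of the set onto which `r` retracts. -/
noncomputable def retractionTangent (r : V → V) (a : V) : Submodule ℝ V := (fderiv ℝ r a).range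

namespace IsLocalRetraction

theorem eventually_differentiableAt (h : IsLocalRetraction r S a) :
    ∀ᶠ x in 𝓝 a, DifferentiableAt ℝ r x := by
  filter_upwards [h.contDiffAt.eventually (by simp)] with x hx
  exact hx.differentiableAt (by simp)

theorem hasFDerivAt (h : IsLocalRetraction r S a) : HasFDerivAt r (fderiv ℝ r a) a :=
  h.eventually_differentiableAt.self_of_nhds.hasFDerivAt

theorem apply_self (h : IsLocalRetraction r S a) (ha : a ∈ S) : r a = a :=
  h.fix.self_of_nhds ha

theorem tendsto (h : IsLocalRetraction r S a) (ha : a ∈ S) : Tendsto r (𝓝 a) (𝓝 a) := by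
  simpa only [ContinuousAt, h.apply_self ha] using h.contDiffAt.continuousAt

theorem fderiv_comp (h : IsLocalRetraction r S a) (ha : a ∈ S) {φ : V → V} {φ' : V →L[ℝ] V}
    (hφ : HasFDerivAt φ φ' a) (hfix : ∀ᶠ x in 𝓝 a, x ∈ S → φ x = x) :
    φ'.comp (fderiv ℝ r a) = fderiv ℝ r a := by
  have hcomp : HasFDerivAt (φ ∘ r) (φ'.comp (fderiv ℝ r a)) a :=
    HasFDerivAt.comp a (by rwa [h.apply_self ha]) h.hasFDerivAt
  have heq : φ ∘ r =ᶠ[𝓝 a] r := by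
    filter_upwards [h.mem, (h.tendsto ha).eventually hfix] with x hx hxfix
    exact hxfix hx
  exact hcomp.unique (h.hasFDerivAt.congr_of_eventuallyEq heq)

theorem mem_tangent_iff (h : IsLocalRetraction r S a) (ha : a ∈ S) {v : V} :
    v ∈ retractionTangent r a ↔ fderiv ℝ r a v = v := by
  refine ⟨?_, fun hv => ⟨v, hv⟩⟩
  rintro ⟨w, rfl⟩
  exact DFunLike.congr_fun (h.fderiv_comp ha h.hasFDerivAt h.fix) w

theorem tangent_mono (h : IsLocalRetraction r S a) (h' : IsLocalRetraction r' S' a) (ha : a ∈ S)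
    (hSS' : S ⊆ S') : retractionTangent r a ≤ retractionTangent r' a := by
  rintro _ ⟨w, rfl⟩
  have hcomp := h.fderiv_comp ha h'.hasFDerivAt (h'.fix.mono fun x hx hxS => hx (hSS' hxS))
  exact ⟨fderiv ℝ r a w, DFunLike.congr_fun hcomp w⟩

theorem tangent_le_submodule (h : IsLocalRetraction r S a) (ha : a ∈ S) {L : Submodule ℝ V}
    (hL : L.ClosedComplemented) (hSL : S ⊆ L) : retractionTangent r a ≤ L := by
  obtain ⟨f, hf⟩ := hL
  rintro _ ⟨w, rfl⟩
  have hcomp := h.fderiv_comp ha (L.subtypeL.comp f).hasFDerivAt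
    (Eventually.of_forall fun x hx => congrArg Subtype.val (hf ⟨x, hSL hx⟩))
  have hw : (f (fderiv ℝ r a w) : V) = fderiv ℝ r a w := DFunLike.congr_fun hcomp w
  exact hw ▸ (f (fderiv ℝ r a w)).2

theorem conj (h : IsLocalRetraction r S a) (e : V ≃L[ℝ] W) :
    IsLocalRetraction (e ∘ r ∘ e.symm) (e.symm ⁻¹' S) (e a) := by
  have htendsto : Tendsto e.symm (𝓝 (e a)) (𝓝 a) := by
    simpa using e.symm.continuous.tendsto (e a)
  refine ⟨?_, ?_, ?_⟩
  · refine e.contDiff.contDiffAt.comp _ (ContDiffAt.comp _ ?_ e.symm.contDiff.contDiffAt)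
    rw [e.symm_apply_apply]
    exact h.contDiffAt
  · filter_upwards [htendsto.eventually h.mem] with x hx
    simpa using hx
  · filter_upwards [htendsto.eventually h.fix] with x hx hxS
    simp [hx hxS]

theorem tangent_conj (h : IsLocalRetraction r S a) (e : V ≃L[ℝ] W) :
    retractionTangent (e ∘ r ∘ e.symm) (e a) =
      (retractionTangent r a).map (e : V ≃ₗ[ℝ] W).toLinearMap := by
  have hr : HasFDerivAt r (fderiv ℝ r a) (e.symm (e a)) := by
    rw [e.symm_apply_apply]
    exact h.hasFDerivAt
  have hconj : HasFDerivAt (e ∘ r ∘ e.symm) _ (e a) :=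
    e.hasFDerivAt.comp _ (hr.comp _ e.symm.hasFDerivAt)
  rw [retractionTangent, hconj.fderiv]
  ext w
  constructor
  · rintro ⟨v, rfl⟩
    exact ⟨fderiv ℝ r a (e.symm v), ⟨e.symm v, rfl⟩, rfl⟩
  · rintro ⟨_, ⟨v, rfl⟩, rfl⟩
    exact ⟨e v, by simp⟩

theorem exists_quadratic_bound (h : IsLocalRetraction r S a) :
    ∃ K : NNReal, ∃ t ∈ 𝓝 a, ∀ x ∈ t, ∀ y ∈ t, x ∈ S → y ∈ S →
      ‖y - x - fderiv ℝ r x (y - x)‖ ≤ K * ‖y - x‖ ^ 2 := by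
  obtain ⟨K, t, ht, hlip⟩ :=
    (h.contDiffAt.fderiv_right (m := 1) (by norm_num)).exists_lipschitzOnWith
  obtain ⟨ρ, hρ, hball⟩ := Metric.mem_nhds_iff.1
    (inter_mem ht (h.eventually_differentiableAt.and h.fix))
  refine ⟨K, Metric.ball a ρ, Metric.ball_mem_nhds a hρ, fun x hx y hy hxS hyS => ?_⟩
  have hseg : segment ℝ x y ⊆ Metric.ball a ρ := (convex_ball a ρ).segment_subset hx hy
  have hbound := (convex_segment x y).norm_image_sub_le_of_norm_fderiv_le' (𝕜 := ℝ)
    (f := r) (φ := fderiv ℝ r x) (C := K * ‖y - x‖)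
    (fun z hz => (hball (hseg hz)).2.1)
    (fun z hz => (hlip.norm_sub_le (hball (hseg hz)).1 (hball hx).1).trans
      (by gcongr; exact norm_sub_le_of_mem_segment hz))
    (left_mem_segment ℝ x y) (right_mem_segment ℝ x y)
  rw [(hball hx).2.2 hxS, (hball hy).2.2 hyS] at hbound
  rwa [sq, ← mul_assoc]

end IsLocalRetraction

end LocalRetraction

section Projection

variable {E : Type*} [NormedAddCommGroup E] [InnerProductSpace ℝ E]

theorem isUniqueNearest_starProjection (K : Submodule ℝ E) [K.HasOrthogonalProjection] (v : E) :
    IsUniqueNearest (K : Set E) v (K.starProjection v) := by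
  refine ⟨K.starProjection_apply_mem v, fun y hy hne => ?_⟩
  have horth : inner ℝ (v - K.starProjection v) (K.starProjection v - y) = 0 :=
    K.starProjection_inner_eq_zero v _ (K.sub_mem (K.starProjection_apply_mem v) hy)
  have hpyth : ‖v - y‖ ^ 2 = ‖v - K.starProjection v‖ ^ 2 + ‖K.starProjection v - y‖ ^ 2 := by
    rw [← sub_add_sub_cancel v (K.starProjection v) y, norm_add_sq_real, horth]
    ring
  have hpos : 0 < ‖K.starProjection v - y‖ := norm_sub_pos_iff.2 hne.symm
  exact lt_of_pow_lt_pow_left₀ 2 (norm_nonneg _) (by linarith [pow_pos hpos 2])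

theorem norm_sub_starProjection_le (K : Submodule ℝ E) [K.HasOrthogonalProjection] (v : E) {w : E}
    (hw : w ∈ K) : ‖v - K.starProjection v‖ ≤ ‖v - w‖ := by
  obtain rfl | hne := eq_or_ne w (K.starProjection v)
  · rfl
  · exact ((isUniqueNearest_starProjection K v).2 w hw hne).le

theorem starProjection_starProjection_of_le {K₁ K₂ : Submodule ℝ E} [K₁.HasOrthogonalProjection]
    [K₂.HasOrthogonalProjection] (hle : K₁ ≤ K₂) (v : E) :
    K₁.starProjection (K₂.starProjection v) = K₁.starProjection v :=
  DFunLike.congr_fun (Submodule.starProjection_comp_starProjection_of_le hle) v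

theorem norm_starProjection_lt_of_mem_orthogonal {τ L : Submodule ℝ E} [τ.HasOrthogonalProjection]
    {v : E} (hvL : v ∈ L) (hv : v ∈ (τ ⊓ L)ᗮ) (hv0 : v ≠ 0) : ‖τ.starProjection v‖ < ‖v‖ := by
  refine lt_of_le_of_ne (τ.norm_starProjection_apply_le v) fun heq => hv0 ?_
  exact inner_self_eq_zero.1 (hv v ⟨(τ.mem_iff_norm_starProjection v).2 heq, hvL⟩)

variable [FiniteDimensional ℝ E]

theorem exists_angle_bound (τ L : Submodule ℝ E) :
    ∃ c : ℝ, 0 ≤ c ∧ c < 1 ∧ ∀ v ∈ L, v ∈ (τ ⊓ L)ᗮ → ‖τ.starProjection v‖ ≤ c * ‖v‖ := by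
  let Q : Submodule ℝ E := L ⊓ (τ ⊓ L)ᗮ
  have hcompact : IsCompact (Metric.sphere (0 : E) 1 ∩ Q) :=
    have : ProperSpace E := FiniteDimensional.proper ℝ E
    (isCompact_sphere 0 1).inter_right Q.closed_of_finiteDimensional
  have hnormalize : ∀ v ∈ Q, v ≠ 0 → ‖v‖⁻¹ • v ∈ Metric.sphere (0 : E) 1 ∩ Q :=
    fun v hv hv0 => ⟨by simp [norm_smul, hv0], Q.smul_mem _ hv⟩
  rcases (Metric.sphere (0 : E) 1 ∩ Q).eq_empty_or_nonempty with hempty | hne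
  · refine ⟨0, le_rfl, one_pos, fun v hv hv' => ?_⟩
    obtain rfl : v = 0 := by
      by_contra hv0
      exact (hempty ▸ hnormalize v ⟨hv, hv'⟩ hv0 : _ ∈ (∅ : Set E))
    simp
  · obtain ⟨u, ⟨hu1, huQ⟩, hmax⟩ := hcompact.exists_isMaxOn hne
      (f := fun v => ‖τ.starProjection v‖) (by fun_prop)
    rw [mem_sphere_zero_iff_norm] at hu1
    refine ⟨‖τ.starProjection u‖, norm_nonneg _, ?_, fun v hv hv' => ?_⟩
    · have hu0 : u ≠ 0 := norm_ne_zero_iff.1 (by rw [hu1]; exact one_ne_zero)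
      exact hu1 ▸ norm_starProjection_lt_of_mem_orthogonal huQ.1 huQ.2 hu0
    · obtain rfl | hv0 := eq_or_ne v 0
      · simp
      have hle : ‖τ.starProjection (‖v‖⁻¹ • v)‖ ≤ ‖τ.starProjection u‖ :=
        hmax (hnormalize v ⟨hv, hv'⟩ hv0)
      rwa [map_smul, norm_smul, norm_inv, norm_norm, inv_mul_le_iff₀ (norm_pos_iff.2 hv0),
        mul_comm] at hle

theorem exists_norm_starProjection_le_add {τ L σ : Submodule ℝ E} (hσ : τ ⊓ L ≤ σ) :
    ∃ c : ℝ, 0 ≤ c ∧ c < 1 ∧ ∀ v ∈ L,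
      ‖τ.starProjection v‖ ≤ c * ‖v‖ + ‖σ.starProjection v‖ := by
  obtain ⟨c, hc0, hc1, hc⟩ := exists_angle_bound τ L
  refine ⟨c, hc0, hc1, fun v hv => ?_⟩
  set u := (τ ⊓ L).starProjection v
  have huL : u ∈ τ ⊓ L := Submodule.starProjection_apply_mem _ v
  have hangle : ‖τ.starProjection (v - u)‖ ≤ c * ‖v - u‖ :=
    hc _ (L.sub_mem hv huL.2) (Submodule.sub_starProjection_mem_orthogonal v)
  have hle : ‖v - u‖ ≤ ‖v‖ := by
    simpa using norm_sub_starProjection_le (τ ⊓ L) v (Submodule.zero_mem _)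
  have hu : ‖u‖ ≤ ‖σ.starProjection v‖ := by
    simpa only [starProjection_starProjection_of_le hσ]
      using (τ ⊓ L).norm_starProjection_apply_le (σ.starProjection v)
  calc ‖τ.starProjection v‖ = ‖τ.starProjection (v - u) + u‖ := by
        rw [map_sub, Submodule.starProjection_eq_self_iff.2 huL.1, sub_add_cancel]
    _ ≤ c * ‖v - u‖ + ‖u‖ := (norm_add_le _ _).trans (by gcongr)
    _ ≤ c * ‖v‖ + ‖σ.starProjection v‖ := by gcongr

end Projection

namespace IsLocalRetraction

variable {E : Type*} [NormedAddCommGroup E] [InnerProductSpace ℝ E] {r : E → E} {S : Set E} {a : E}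

theorem inner_fderiv_eq_zero (h : IsLocalRetraction r S a) :
    ∀ᶠ x in 𝓝 a, ∀ b, IsNearest S b x → ∀ v, inner ℝ (b - x) (fderiv ℝ r x v) = 0 := by
  filter_upwards [h.eventually_differentiableAt, h.mem.eventually_nhds, h.fix]
    with x hdiff hmem hfix b hb v
  have hx : r x = x := hfix hb.1
  have hmin : IsLocalMin (fun y => ‖b - r y‖ ^ 2) x := by
    filter_upwards [hmem] with y hy
    simp only [hx]
    exact pow_le_pow_left₀ (norm_nonneg _) (hb.2 _ hy) 2
  have hzero := DFunLike.congr_fun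
    (hmin.hasFDerivAt_eq_zero (hdiff.hasFDerivAt.const_sub b).norm_sq) v
  simp only [hx, smul_apply, ContinuousLinearMap.comp_apply, innerSL_apply_apply, neg_apply,
    inner_neg_right, zero_apply] at hzero
  simpa using hzero

theorem eventually_nearest_unique (h : IsLocalRetraction r S a) (ha : a ∈ S) :
    ∀ᶠ b in 𝓝 a, ∀ x y, IsNearest S b x → IsNearest S b y → x = y := by
  obtain ⟨K, t, ht, hquad⟩ := h.exists_quadratic_bound
  have hsmall : ∀ᶠ b in 𝓝 a, 2 * (‖b - a‖ * K) < 1 := by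
    have hcont : Continuous fun b : E => 2 * (‖b - a‖ * K) := by fun_prop
    exact hcont.tendsto a |>.eventually_lt_const (by simp)
  filter_upwards [eventually_forall_isNearest ha ht,
    eventually_forall_isNearest ha h.inner_fderiv_eq_zero, hsmall] with b hbt horth hb x y hx hy
  have horth : inner ℝ (b - x) (fderiv ℝ r x (y - x)) = 0 := horth x hx b hx (y - x)
  have heq : ‖b - y‖ = ‖b - x‖ := le_antisymm (hy.2 x hx.1) (hx.2 y hy.1)
  have hexpand : ‖b - y‖ ^ 2 = ‖b - x‖ ^ 2 - 2 * inner ℝ (b - x) (y - x) + ‖y - x‖ ^ 2 := by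
    rw [← norm_sub_sq_real, sub_sub_sub_cancel_right]
  have hinner : inner ℝ (b - x) (y - x) ≤ ‖b - a‖ * (K * ‖y - x‖ ^ 2) :=
    calc inner ℝ (b - x) (y - x) = inner ℝ (b - x) (y - x - fderiv ℝ r x (y - x)) := by
          rw [inner_sub_right (b - x) (y - x), horth, sub_zero]
      _ ≤ ‖b - x‖ * ‖y - x - fderiv ℝ r x (y - x)‖ := real_inner_le_norm _ _
      _ ≤ ‖b - a‖ * (K * ‖y - x‖ ^ 2) := by
          gcongr
          · exact hx.2 a ha
          · exact hquad x (hbt x hx) y (hbt y hy) hx.1 hy.1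
  rw [heq] at hexpand
  have hsq : ‖y - x‖ ^ 2 = 0 := by nlinarith [sq_nonneg ‖y - x‖]
  exact (sub_eq_zero.1 (norm_eq_zero.1 (pow_eq_zero_iff two_ne_zero |>.1 hsq))).symm

variable [FiniteDimensional ℝ E]

theorem chord_estimate (h : IsLocalRetraction r S a) {δ : ℝ} (hδ : 0 < δ) :
    ∃ t ∈ 𝓝 a, ∀ x ∈ t, ∀ y ∈ t, x ∈ S → y ∈ S →
      ‖y - x - (retractionTangent r a).starProjection (y - x)‖ ≤ δ * ‖y - x‖ := by
  have hstrict := (h.contDiffAt.hasStrictFDerivAt (by simp)).isLittleO.def hδ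
  rw [nhds_prod_eq] at hstrict
  obtain ⟨t, ht, hbound⟩ := eventually_prod_self_iff
    (r := fun y x => ‖r y - r x - fderiv ℝ r a (y - x)‖ ≤ δ * ‖y - x‖).1 hstrict
  refine ⟨_, inter_mem ht h.fix, fun x hx y hy hxS hyS => ?_⟩
  have hxy := hbound y hy.1 x hx.1
  rw [hx.2 hxS, hy.2 hyS] at hxy
  exact (norm_sub_starProjection_le _ _ (LinearMap.mem_range_self _ (y - x))).trans hxy

theorem normal_estimate (h : IsLocalRetraction r S a) (ha : a ∈ S) {δ : ℝ} (hδ : 0 < δ) :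
    ∀ᶠ x in 𝓝 a, ∀ b, IsNearest S b x →
      ‖(retractionTangent r a).starProjection (b - x)‖ ≤ δ * ‖b - x‖ := by
  have hcont : Tendsto (fun x => ‖fderiv ℝ r x - fderiv ℝ r a‖) (𝓝 a) (𝓝 0) := by
    simpa using ((h.contDiffAt.fderiv_right (m := 1) (by norm_num)).continuousAt.sub_const
      (fderiv ℝ r a)).norm
  filter_upwards [hcont.eventually_lt_const hδ, h.inner_fderiv_eq_zero] with x hclose horth b hb
  set w := (retractionTangent r a).starProjection (b - x)
  have hw : w ∈ retractionTangent r a := Submodule.starProjection_apply_mem _ _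
  have hinner : inner ℝ (b - x) w = ‖w‖ ^ 2 := by
    have hperp : inner ℝ (b - x - w) w = 0 := Submodule.starProjection_inner_eq_zero _ w hw
    rwa [inner_sub_left, real_inner_self_eq_norm_sq, sub_eq_zero] at hperp
  have hsq : ‖w‖ ^ 2 ≤ δ * ‖b - x‖ * ‖w‖ :=
    calc ‖w‖ ^ 2 = -inner ℝ (b - x) ((fderiv ℝ r x - fderiv ℝ r a) w) := by
          rw [sub_apply, inner_sub_right, horth b hb w, (h.mem_tangent_iff ha).1 hw, hinner]
          ring
      _ ≤ ‖b - x‖ * ‖(fderiv ℝ r x - fderiv ℝ r a) w‖ :=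
          (neg_le_abs _).trans (abs_real_inner_le_norm _ _)
      _ ≤ ‖b - x‖ * (δ * ‖w‖) := by
          gcongr
          exact ((fderiv ℝ r x - fderiv ℝ r a).le_opNorm w).trans (by gcongr)
      _ = δ * ‖b - x‖ * ‖w‖ := by ring
  rcases (norm_nonneg w).eq_or_lt with hzero | hpos
  · rw [← hzero]
    positivity
  · rw [sq] at hsq
    exact le_of_mul_le_mul_right hsq hpos

theorem nearest_approx (h : IsLocalRetraction r S a) (ha : a ∈ S) {δ : ℝ} (hδ : 0 < δ) :
    ∃ t ∈ 𝓝 a, ∀ x ∈ t, ∀ b ∈ t, ∀ q, x ∈ S → IsNearest S b q →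
      ‖q - x - (retractionTangent r a).starProjection (b - x)‖ ≤ δ * ‖b - x‖ := by
  have hδ3 : 0 < δ / 3 := by positivity
  obtain ⟨t, ht, hchord⟩ := h.chord_estimate hδ3
  refine ⟨_, inter_mem ht ((eventually_forall_isNearest ha ht).and
    (eventually_forall_isNearest ha (h.normal_estimate ha hδ3))), ?_⟩
  rintro x ⟨hxt, -⟩ b ⟨-, hbt, hnormal⟩ q hxS hq
  set P := (retractionTangent r a).starProjection
  have hsplit : q - x - P (b - x) = (q - x - P (q - x)) - P (b - q) := by
    rw [← sub_add_sub_cancel b q x, map_add]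
    abel
  rw [hsplit]
  calc ‖q - x - P (q - x) - P (b - q)‖ ≤ ‖q - x - P (q - x)‖ + ‖P (b - q)‖ := norm_sub_le _ _
    _ ≤ δ / 3 * ‖q - x‖ + δ / 3 * ‖b - q‖ :=
        add_le_add (hchord x hxt q (hbt q hq) hxS hq.1) (hnormal q hq b hq)
    _ ≤ δ / 3 * (2 * ‖b - x‖) + δ / 3 * ‖b - x‖ := by
        gcongr
        · exact hq.norm_sub_le hxS
        · exact hq.2 x hxS
    _ = δ * ‖b - x‖ := by ring

end IsLocalRetraction

section Contraction

variable {E : Type*} [NormedAddCommGroup E] [InnerProductSpace ℝ E] [FiniteDimensional ℝ E]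
  {R : Set E} {L : Submodule ℝ E} {a : E} {rR rS : E → E}

theorem eventually_forall_starProjection (haR : a ∈ R) (haL : a ∈ L) {Q : E → Prop}
    (hQ : ∀ᶠ x in 𝓝 a, Q x) :
    ∀ᶠ b in 𝓝 a, ∀ q, IsNearest R b q → Q (L.starProjection q) := by
  refine eventually_forall_isNearest haR ?_
  have htendsto : Tendsto L.starProjection (𝓝 a) (𝓝 a) := by
    simpa only [Submodule.starProjection_eq_self_iff.2 haL]
      using L.starProjection.continuous.tendsto a
  exact htendsto.eventually hQ

theorem norm_starProjection_sub_le (q : E) {p : E} (hp : p ∈ L) :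
    ‖L.starProjection q - p‖ ≤ ‖q - p‖ := by
  simpa only [map_sub, Submodule.starProjection_eq_self_iff.2 hp]
    using L.norm_starProjection_apply_le (q - p)

theorem displacement_estimate (haR : a ∈ R) (haL : a ∈ L) (hR : IsLocalRetraction rR R a)
    (hS : IsLocalRetraction rS (R ∩ L) a) {δ : ℝ} (hδ : 0 < δ) :
    ∀ᶠ b in 𝓝 a, ∀ p q p', IsNearest (R ∩ L) b p → IsNearest R b q →
      IsNearest (R ∩ L) (L.starProjection q) p' → ‖p' - p‖ ≤ δ * ‖b - p‖ := by
  have haS : a ∈ R ∩ L := ⟨haR, haL⟩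
  have hδ4 : 0 < δ / 4 := by positivity
  obtain ⟨t, ht, happroxR⟩ := hR.nearest_approx haR hδ4
  obtain ⟨t', ht', happroxS⟩ := hS.nearest_approx haS hδ4
  filter_upwards [ht, eventually_forall_isNearest haS (inter_mem ht ht'),
    eventually_forall_starProjection haR haL ht',
    eventually_forall_isNearest haS (hS.normal_estimate haS hδ4)]
    with b hbt hpt hqt hnormal p q p' hp hq hp'
  set τ := retractionTangent rR a
  set σ := retractionTangent rS a
  have hστ : σ ≤ τ := hS.tangent_mono hR haS Set.inter_subset_left
  have hσL : σ ≤ L :=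
    hS.tangent_le_submodule haS (.of_finiteDimensional L) Set.inter_subset_right
  have hq_approx : ‖q - p - τ.starProjection (b - p)‖ ≤ δ / 4 * ‖b - p‖ :=
    happroxR p (hpt p hp).1 b hbt q hp.1.1 hq
  have hp'_approx : ‖p' - p - σ.starProjection (L.starProjection q - p)‖ ≤
      δ / 4 * ‖L.starProjection q - p‖ :=
    happroxS p (hpt p hp).2 _ (hqt q hq) p' hp.1 hp'
  have hσ_split : σ.starProjection (L.starProjection q - p) =
      σ.starProjection (q - p - τ.starProjection (b - p)) + σ.starProjection (b - p) := by
    rw [map_sub, starProjection_starProjection_of_le hσL, map_sub σ.starProjection (q - p),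
      starProjection_starProjection_of_le hστ, map_sub, sub_add_cancel]
  calc ‖p' - p‖ = ‖(p' - p - σ.starProjection (L.starProjection q - p)) +
        (σ.starProjection (q - p - τ.starProjection (b - p)) + σ.starProjection (b - p))‖ := by
        rw [hσ_split, sub_add_cancel]
    _ ≤ δ / 4 * ‖L.starProjection q - p‖ +
        (‖q - p - τ.starProjection (b - p)‖ + δ / 4 * ‖b - p‖) :=
        norm_add_le_of_le hp'_approx (norm_add_le_of_le (σ.norm_starProjection_apply_le _)
          (hnormal p hp b hp))
    _ ≤ δ / 4 * (2 * ‖b - p‖) + (δ / 4 * ‖b - p‖ + δ / 4 * ‖b - p‖) := by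
        gcongr
        exact (norm_starProjection_sub_le q hp.1.2).trans (hq.norm_sub_le hp.1.1)
    _ = δ * ‖b - p‖ := by ring

theorem exists_contraction (haR : a ∈ R) (haL : a ∈ L) (hR : IsLocalRetraction rR R a)
    (hS : IsLocalRetraction rS (R ∩ L) a)
    (hclean : retractionTangent rR a ⊓ L ≤ retractionTangent rS a) :
    ∃ κ : ℝ, 0 ≤ κ ∧ κ < 1 ∧ ∀ᶠ b in 𝓝 a, b ∈ L → ∀ p q, IsNearest (R ∩ L) b p →
      IsNearest R b q → ‖q - p‖ ≤ κ * ‖b - p‖ := by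
  have haS : a ∈ R ∩ L := ⟨haR, haL⟩
  obtain ⟨c, hc0, hc1, hangle⟩ := exists_norm_starProjection_le_add hclean
  have hδ : 0 < (1 - c) / 4 := by linarith
  obtain ⟨t, ht, happrox⟩ := hR.nearest_approx haR hδ
  refine ⟨(1 + c) / 2, by linarith, by linarith, ?_⟩
  filter_upwards [ht, eventually_forall_isNearest haS ht,
    eventually_forall_isNearest haS (hS.normal_estimate haS hδ)]
    with b hbt hpt hnormal hbL p q hp hq
  set P := (retractionTangent rR a).starProjection
  calc ‖q - p‖ = ‖(q - p - P (b - p)) + P (b - p)‖ := by rw [sub_add_cancel]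
    _ ≤ (1 - c) / 4 * ‖b - p‖ + (c * ‖b - p‖ + (1 - c) / 4 * ‖b - p‖) :=
        norm_add_le_of_le (happrox p (hpt p hp) b hbt q hp.1.1 hq)
          ((hangle _ (L.sub_mem hbL hp.1.2)).trans (by gcongr; exact hnormal p hp b hp))
    _ = (1 + c) / 2 * ‖b - p‖ := by ring

end Contraction

section Interleave

variable {X : Type*}

/-- The sequence `u 0, v 0, u 1, v 1, …`. -/
def interleave (u v : ℕ → X) (j : ℕ) : X := if Even j then u (j / 2) else v (j / 2)

@[simp]
theorem interleave_two_mul (u v : ℕ → X) (i : ℕ) : interleave u v (2 * i) = u i := by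
  simp [interleave]

@[simp]
theorem interleave_two_mul_add_one (u v : ℕ → X) (i : ℕ) :
    interleave u v (2 * i + 1) = v i := by
  rw [interleave, if_neg (Nat.not_even_two_mul_add_one i)]
  congr 1
  lia

theorem tendsto_interleave {u v : ℕ → X} {l : Filter X} (hu : Tendsto u atTop l)
    (hv : Tendsto v atTop l) : Tendsto (interleave u v) atTop l := by
  have hdiv : Tendsto (fun j : ℕ => j / 2) atTop atTop :=
    Nat.tendsto_div_const_atTop two_ne_zero
  intro s hs
  rw [Filter.mem_map]
  filter_upwards [hdiv.eventually (hu hs), hdiv.eventually (hv hs)] with j hju hjv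
  rw [Set.mem_preimage, interleave]
  split_ifs
  exacts [hju, hjv]

end Interleave

/-- `B` is the sequence of alternating projections started at `b`: first onto `R`, then onto `S`,
and so on, all nearest points being unique. -/
def IsAlternatingNearestSeq {E : Type*} [NormedAddCommGroup E] (R S : Set E) (b : E)
    (B : ℕ → E) : Prop :=
  B 0 = b ∧ ∀ j, (Even j → IsUniqueNearest R (B j) (B (j + 1))) ∧
    (Odd j → IsUniqueNearest S (B j) (B (j + 1)))

theorem isAlternatingNearestSeq_interleave {E : Type*} [NormedAddCommGroup E] {R S : Set E}
    {β q : ℕ → E} (hq : ∀ i, IsUniqueNearest R (β i) (q i))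
    (hβ : ∀ i, IsUniqueNearest S (q i) (β (i + 1))) :
    IsAlternatingNearestSeq R S (β 0) (interleave β q) := by
  refine ⟨interleave_two_mul β q 0, fun j => ⟨fun hj => ?_, fun hj => ?_⟩⟩
  · obtain ⟨i, rfl⟩ := even_iff_exists_two_mul.1 hj
    simpa using hq i
  · obtain ⟨i, rfl⟩ := hj
    simpa [show 2 * i + 1 + 1 = 2 * (i + 1) by ring] using hβ i

section ContractingPair

variable {X : Type*} [PseudoMetricSpace X] {β p : ℕ → X} {a : X} {κ m ρ : ℝ}

theorem dist_lt_of_pair_bounds (hκ0 : 0 ≤ κ) (hκ1 : κ ≤ 1) (hm : 0 ≤ m)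
    (hρ : (1 + m) * dist (β 0) (p 0) + dist (p 0) a < ρ) {j : ℕ}
    (hβp : dist (β j) (p j) ≤ κ ^ j * dist (β 0) (p 0))
    (hp : dist (p j) (p 0) ≤ m * (1 - κ ^ j) * dist (β 0) (p 0)) : dist (β j) a < ρ := by
  refine lt_of_le_of_lt ?_ hρ
  calc dist (β j) a ≤ dist (β j) (p j) + dist (p j) (p 0) + dist (p 0) a :=
        dist_triangle4 _ _ _ _
    _ ≤ 1 * dist (β 0) (p 0) + m * 1 * dist (β 0) (p 0) + dist (p 0) a := by
        gcongr
        · exact hβp.trans (by gcongr; exact pow_le_one₀ hκ0 hκ1)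
        · exact hp.trans (by gcongr; exact sub_le_self _ (pow_nonneg hκ0 j))
    _ = (1 + m) * dist (β 0) (p 0) + dist (p 0) a := by ring

theorem pair_bounds (hκ0 : 0 ≤ κ) (hκ1 : κ ≤ 1) (hm : 0 ≤ m)
    (hρ : (1 + m) * dist (β 0) (p 0) + dist (p 0) a < ρ)
    (hstep : ∀ j, dist (β j) a < ρ → dist (p (j + 1)) (p j) ≤ m * (1 - κ) * dist (β j) (p j) ∧
      dist (β (j + 1)) (p (j + 1)) ≤ κ * dist (β j) (p j)) (j : ℕ) :
    dist (β j) (p j) ≤ κ ^ j * dist (β 0) (p 0) ∧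
      dist (p j) (p 0) ≤ m * (1 - κ ^ j) * dist (β 0) (p 0) := by
  induction j with
  | zero => simp
  | succ j ih =>
    obtain ⟨hβp, hp⟩ := ih
    obtain ⟨hdisp, hcontr⟩ := hstep j (dist_lt_of_pair_bounds hκ0 hκ1 hm hρ hβp hp)
    have : 0 ≤ m * (1 - κ) := mul_nonneg hm (sub_nonneg.2 hκ1)
    constructor
    · calc dist (β (j + 1)) (p (j + 1)) ≤ κ * (κ ^ j * dist (β 0) (p 0)) :=
            hcontr.trans (by gcongr)
        _ = κ ^ (j + 1) * dist (β 0) (p 0) := by ring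
    · calc dist (p (j + 1)) (p 0) ≤ dist (p (j + 1)) (p j) + dist (p j) (p 0) :=
            dist_triangle _ _ _
        _ ≤ m * (1 - κ) * (κ ^ j * dist (β 0) (p 0)) + m * (1 - κ ^ j) * dist (β 0) (p 0) :=
            add_le_add (hdisp.trans (by gcongr)) hp
        _ = m * (1 - κ ^ (j + 1)) * dist (β 0) (p 0) := by ring

theorem exists_tendsto_of_pair [CompleteSpace X] (hκ0 : 0 ≤ κ) (hκ1 : κ < 1) (hm : 0 ≤ m)
    (hρ : (1 + m) * dist (β 0) (p 0) + dist (p 0) a < ρ)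
    (hstep : ∀ j, dist (β j) a < ρ → dist (p (j + 1)) (p j) ≤ m * (1 - κ) * dist (β j) (p j) ∧
      dist (β (j + 1)) (p (j + 1)) ≤ κ * dist (β j) (p j)) :
    (∀ j, dist (β j) a < ρ) ∧ ∃ x, Tendsto β atTop (𝓝 x) ∧ Tendsto p atTop (𝓝 x) ∧
      dist x (p 0) ≤ m * dist (β 0) (p 0) := by
  have hbounds := pair_bounds hκ0 hκ1.le hm hρ hstep
  have hball : ∀ j, dist (β j) a < ρ := fun j =>
    dist_lt_of_pair_bounds hκ0 hκ1.le hm hρ (hbounds j).1 (hbounds j).2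
  have : 0 ≤ m * (1 - κ) := mul_nonneg hm (sub_nonneg.2 hκ1.le)
  have hcauchy : CauchySeq p :=
    cauchySeq_of_le_geometric κ (m * (1 - κ) * dist (β 0) (p 0)) hκ1 fun j =>
      calc dist (p j) (p (j + 1)) ≤ m * (1 - κ) * dist (β j) (p j) :=
            (dist_comm _ _).trans_le (hstep j (hball j)).1
        _ ≤ m * (1 - κ) * (κ ^ j * dist (β 0) (p 0)) := by gcongr; exact (hbounds j).1
        _ = m * (1 - κ) * dist (β 0) (p 0) * κ ^ j := by ring
  obtain ⟨x, hx⟩ := cauchySeq_tendsto_of_complete hcauchy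
  have hgap : Tendsto (fun j => dist (p j) (β j)) atTop (𝓝 0) := by
    refine squeeze_zero (fun _ => dist_nonneg)
      (fun j => (dist_comm _ _).trans_le (hbounds j).1) ?_
    simpa using (tendsto_pow_atTop_nhds_zero_of_lt_one hκ0 hκ1).mul_const (dist (β 0) (p 0))
  refine ⟨hball, x, hx.congr_dist hgap, hx, ?_⟩
  refine le_of_tendsto (hx.dist tendsto_const_nhds) (Eventually.of_forall fun j => ?_)
  refine (hbounds j).2.trans (mul_le_mul_of_nonneg_right ?_ dist_nonneg)
  exact mul_le_of_le_one_right hm (sub_le_self _ (pow_nonneg hκ0 j))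

end ContractingPair

section AlternatingProjections

variable {E : Type*} [NormedAddCommGroup E] [InnerProductSpace ℝ E] [FiniteDimensional ℝ E]
  {R : Set E} {L : Submodule ℝ E} {a : E} {rR rS : E → E}

/- With displacement at most `m (1 - κ)` times the distance to the intersection, and that distance
shrinking by the factor `κ`, the total displacement is at most `m` times the initial distance. -/
theorem exists_contraction_pair (haR : a ∈ R) (haL : a ∈ L) (hR : IsLocalRetraction rR R a)
    (hS : IsLocalRetraction rS (R ∩ L) a)
    (hclean : retractionTangent rR a ⊓ L ≤ retractionTangent rS a) {m : ℝ} (hm : 0 < m) :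
    ∃ κ : ℝ, 0 ≤ κ ∧ κ < 1 ∧ ∀ᶠ b in 𝓝 a, b ∈ L → ∀ p q p', IsNearest (R ∩ L) b p →
      IsNearest R b q → IsNearest (R ∩ L) (L.starProjection q) p' →
        ‖p' - p‖ ≤ m * (1 - κ) * ‖b - p‖ ∧ ‖L.starProjection q - p'‖ ≤ κ * ‖b - p‖ := by
  obtain ⟨κ, hκ0, hκ1, hcontr⟩ := exists_contraction haR haL hR hS hclean
  refine ⟨κ, hκ0, hκ1, ?_⟩
  filter_upwards [hcontr, displacement_estimate haR haL hR hS (mul_pos hm (sub_pos.2 hκ1))]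
    with b hcontr hdisp hbL p q p' hp hq hp'
  exact ⟨hdisp p q p' hp hq hp', (hp'.2 p hp.1).trans
    ((norm_starProjection_sub_le q hp.1.2).trans (hcontr hbL p q hp hq))⟩

theorem eventually_alternatingProjections (hRc : IsClosed R) (haR : a ∈ R) (haL : a ∈ L)
    (hR : IsLocalRetraction rR R a) (hS : IsLocalRetraction rS (R ∩ L) a)
    (hclean : retractionTangent rR a ⊓ L ≤ retractionTangent rS a) {ε : ℝ} (hε : 0 < ε)
    {W : Set E} (hW : W ∈ 𝓝 a) :
    ∀ᶠ b in 𝓝 a, b ∈ L → ∃ (B : ℕ → E) (p x : E), IsAlternatingNearestSeq R L b B ∧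
      IsUniqueNearest (R ∩ L) b p ∧ Tendsto B atTop (𝓝 x) ∧ x ∈ R ∩ L ∧ x ∈ W ∧
      ‖x - p‖ ≤ ε * ‖b - p‖ := by
  have : ProperSpace E := FiniteDimensional.proper ℝ E
  have haS : a ∈ R ∩ (L : Set E) := ⟨haR, haL⟩
  have hSc : IsClosed (R ∩ (L : Set E)) := hRc.inter L.closed_of_finiteDimensional
  choose nR hnR using exists_isNearest hRc ⟨a, haR⟩
  choose nS hnS using exists_isNearest hSc ⟨a, haS⟩
  obtain ⟨κ, hκ0, hκ1, hstep⟩ := exists_contraction_pair haR haL hR hS hclean hε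
  obtain ⟨ρ, hρ, hball⟩ := Metric.eventually_nhds_iff_ball.1
    (hstep.and ((hR.eventually_nearest_unique haR).and
      ((hS.eventually_nearest_unique haS).and hW)))
  have hs : 0 < ρ / (ε + 3) := by positivity
  filter_upwards [Metric.ball_mem_nhds a hs] with b hb hbL
  let β : ℕ → E := fun j => (fun x => L.starProjection (nR x))^[j] b
  have hβ_succ : ∀ j, β (j + 1) = L.starProjection (nR (β j)) := fun j =>
    Function.iterate_succ_apply' _ j b
  have hβL : ∀ j, β j ∈ L
    | 0 => hbL
    | j + 1 => hβ_succ j ▸ Submodule.starProjection_apply_mem _ _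
  have hstart : (1 + ε) * dist (β 0) (nS (β 0)) + dist (nS (β 0)) a < ρ :=
    ((hnS b).mul_dist_add_dist_le haS hε.le).trans_lt ((lt_div_iff₀' (by positivity)).1 hb)
  obtain ⟨hstay, x, hβx, hpx, hxp⟩ := exists_tendsto_of_pair (β := β) (p := fun j => nS (β j))
    (a := a) hκ0 hκ1 hε.le hstart fun j hj => by
      simp only [dist_eq_norm, hβ_succ]
      exact (hball (β j) hj).1 (hβL j) _ _ _ (hnS _) (hnR _) (hnS _)
  have hxS : x ∈ R ∩ (L : Set E) := hSc.mem_of_tendsto hpx (Eventually.of_forall fun j => (hnS _).1)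
  have hxa : dist x a < ρ := by
    linarith [dist_triangle x (nS (β 0)) a, dist_nonneg (x := β 0) (y := nS (β 0))]
  refine ⟨interleave β (fun j => nR (β j)), nS b, x, ?_, ?_, ?_, hxS, (hball x hxa).2.2.2, ?_⟩
  · exact isAlternatingNearestSeq_interleave
      (fun j => (hnR _).isUniqueNearest (hball _ (hstay j)).2.1)
      (fun j => hβ_succ j ▸ isUniqueNearest_starProjection L _)
  · exact (hnS b).isUniqueNearest (hball _ (hstay 0)).2.2.1
  · exact tendsto_interleave hβx (tendsto_isNearest hxS.1 (fun j => hnR (β j)) hβx)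
  · rwa [dist_eq_norm, dist_eq_norm] at hxp

end AlternatingProjections

theorem eventually_alternatingProjections_preimage {V E : Type*} [NormedAddCommGroup V]
    [NormedSpace ℝ V] [NormedAddCommGroup E] [InnerProductSpace ℝ E] [FiniteDimensional ℝ E]
    (e : V ≃L[ℝ] E) {R : Set V} {L : Submodule ℝ V} {rR rS : V → V} {a : V}
    (hRc : IsClosed R) (haR : a ∈ R) (haL : a ∈ L) (hR : IsLocalRetraction rR R a)
    (hS : IsLocalRetraction rS (R ∩ L) a)
    (hclean : retractionTangent rR a ⊓ L ≤ retractionTangent rS a) {ε : ℝ} (hε : 0 < ε)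
    {W : Set V} (hW : W ∈ 𝓝 a) :
    ∀ᶠ b in 𝓝 (e a), e.symm b ∈ L → ∃ (B : ℕ → E) (p x : E),
      IsAlternatingNearestSeq (e.symm ⁻¹' R) (e.symm ⁻¹' L) b B ∧
      IsUniqueNearest (e.symm ⁻¹' (R ∩ L)) b p ∧ Tendsto B atTop (𝓝 x) ∧
      e.symm x ∈ R ∩ L ∧ e.symm x ∈ W ∧ ‖x - p‖ ≤ ε * ‖b - p‖ := by
  have hW' : e.symm ⁻¹' W ∈ 𝓝 (e a) :=
    e.symm.continuous.continuousAt.preimage_mem_nhds (by rwa [e.symm_apply_apply])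
  have hclean' : retractionTangent (e ∘ rR ∘ e.symm) (e a) ⊓ L.comap e.symm.toLinearMap ≤
      retractionTangent (e ∘ rS ∘ e.symm) (e a) := by
    rw [hR.tangent_conj e, hS.tangent_conj e]
    rintro _ ⟨⟨v, hv, rfl⟩, hvL⟩
    exact ⟨v, hclean ⟨hv, by simpa using hvL⟩, rfl⟩
  exact eventually_alternatingProjections (hRc.preimage e.symm.continuous) (by simpa using haR)
    (by simpa using haL) (hR.conj e) (hS.conj e) hclean' hε hW'

section Submanifolds

variable {V F H : Type*} [NormedAddCommGroup V] [NormedSpace ℝ V]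
  [NormedAddCommGroup F] [NormedSpace ℝ F] [NormedAddCommGroup H] [NormedSpace ℝ H]

theorem isSubmanifold_regular_zeros [FiniteDimensional ℝ V] [FiniteDimensional ℝ H] {d : ℕ}
    {U : Set V} {g : V → H}
    (hU : IsOpen U) (hg : ContDiffOn ℝ ∞ g U)
    (hreg : ∀ x ∈ U, g x = 0 → Function.Surjective (fderiv ℝ g x))
    (hd : d + Module.finrank ℝ H = Module.finrank ℝ V) :
    IsSubmanifold d {x ∈ U | g x = 0} := by
  let e : H ≃L[ℝ] (Fin (Module.finrank ℝ H) → ℝ) := ContinuousLinearEquiv.ofFinrankEq (by simp)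
  refine ⟨Module.finrank ℝ H, hd, fun x hx =>
    ⟨U, e ∘ g, hU, hx.1, e.contDiff.comp_contDiffOn hg, ?_, ?_⟩⟩
  · rw [e.comp_fderiv]
    exact e.surjective.comp (hreg x hx.1 hx.2)
  · ext y
    simp +contextual [and_comm]

theorem surjective_fderiv_graph_equation {π : V →L[ℝ] F} {κ : V →L[ℝ] π.ker}
    (hκ : ∀ z : π.ker, κ z = z) {φ : F → V} {h : F → H} {x : V}
    (hφ : DifferentiableAt ℝ φ (π x)) (hsec : ∀ᶠ u in 𝓝 (π x), π (φ u) = u)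
    (hh : DifferentiableAt ℝ h (π x)) (hreg : Function.Surjective (fderiv ℝ h (π x))) :
    Function.Surjective (fderiv ℝ (fun y => (κ (y - φ (π y)), h (π y))) x) := by
  have hsec' : ∀ u, π (fderiv ℝ φ (π x) u) = u := fun u =>
    DFunLike.congr_fun ((π.hasFDerivAt.comp (π x) hφ.hasFDerivAt).unique
      ((hasFDerivAt_id (𝕜 := ℝ) (π x)).congr_of_eventuallyEq hsec)) u
  have hφπ := hφ.hasFDerivAt.comp x π.hasFDerivAt
  have hhπ := hh.hasFDerivAt.comp x π.hasFDerivAt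
  have hderiv := ((κ.hasFDerivAt.comp x ((hasFDerivAt_id x).sub hφπ)).prodMk hhπ).fderiv
  rintro ⟨z, w⟩
  obtain ⟨u, rfl⟩ := hreg w
  refine ⟨fderiv ℝ φ (π x) u + z, (DFunLike.congr_fun hderiv _).trans ?_⟩
  have hz : π (z : V) = 0 := z.2
  simp [hsec', hz, hκ]

theorem isSubmanifold_image_section [FiniteDimensional ℝ V] [FiniteDimensional ℝ F]
    [FiniteDimensional ℝ H] {d : ℕ}
    (π : V →L[ℝ] F) (hπ : Function.Surjective π) {φ : F → V} {h : F → H} {O : Set F}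
    (hO : IsOpen O) (hφ : ContDiffOn ℝ ∞ φ O) (hsec : ∀ u ∈ O, π (φ u) = u)
    (hh : ContDiffOn ℝ ∞ h O) (hreg : ∀ u ∈ O, h u = 0 → Function.Surjective (fderiv ℝ h u))
    (hd : d + Module.finrank ℝ H = Module.finrank ℝ F) :
    IsSubmanifold d (φ '' {u ∈ O | h u = 0}) := by
  obtain ⟨κ, hκ⟩ := Submodule.ClosedComplemented.of_finiteDimensional π.ker
  have hπO : Set.MapsTo π (π ⁻¹' O) O := fun y hy => hy
  have hsmooth : ContDiffOn ℝ ∞ (fun y => (κ (y - φ (π y)), h (π y))) (π ⁻¹' O) :=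
    (κ.contDiff.comp_contDiffOn (contDiffOn_id.sub
      (hφ.comp π.contDiff.contDiffOn hπO))).prodMk (hh.comp π.contDiff.contDiffOn hπO)
  have hrank : Module.finrank ℝ F + Module.finrank ℝ π.ker = Module.finrank ℝ V := by
    rw [← (π : V →ₗ[ℝ] F).finrank_range_add_finrank_ker, LinearMap.range_eq_top.2 hπ, finrank_top]
  convert isSubmanifold_regular_zeros (d := d) (hO.preimage π.continuous) hsmooth
    (fun x hx hzero => ?_) ?_ using 1
  · ext y
    simp only [Set.mem_image, Set.mem_ofPred_eq, Set.mem_preimage, Prod.mk_eq_zero]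
    constructor
    · rintro ⟨u, ⟨hu, hhu⟩, rfl⟩
      simp [hsec u hu, hu, hhu]
    · rintro ⟨hy, hκy, hhy⟩
      have hker : y - φ (π y) ∈ π.ker := by simp [LinearMap.mem_ker, hsec _ hy]
      have hzero : y - φ (π y) = 0 := congrArg Subtype.val ((hκ ⟨_, hker⟩).symm.trans hκy)
      exact ⟨π y, ⟨hy, hhy⟩, (sub_eq_zero.1 hzero).symm⟩
  · have hnhds : O ∈ 𝓝 (π x) := hO.mem_nhds hx
    exact surjective_fderiv_graph_equation hκ
      ((hφ.contDiffAt hnhds).differentiableAt (by simp)) (mem_of_superset hnhds hsec)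
      ((hh.contDiffAt hnhds).differentiableAt (by simp))
      (hreg _ hx (congrArg Prod.snd hzero))
  · rw [Module.finrank_prod]
    lia

end Submanifolds

section PolynomialZeros

open MvPolynomial (pderiv coeff_pderiv)

variable {σ : Type*}

theorem totalDegree_pderiv_lt {R : Type*} [CommSemiring R] {p : MvPolynomial σ R} {i : σ}
    (hi : pderiv i p ≠ 0) : (pderiv i p).totalDegree < p.totalDegree := by
  obtain ⟨m, hm, hdeg⟩ : ∃ m ∈ (pderiv i p).support, (pderiv i p).totalDegree = m.degree :=
    Finset.exists_mem_eq_sup _ (MvPolynomial.support_nonempty.2 hi) _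
  have hsupp : m + Finsupp.single i 1 ∈ p.support := by
    rw [MvPolynomial.mem_support_iff, coeff_pderiv] at hm
    exact MvPolynomial.mem_support_iff.2 (left_ne_zero_of_mul hm)
  calc (pderiv i p).totalDegree < (m + Finsupp.single i 1).degree := by simp [hdeg, map_add]
    _ ≤ p.totalDegree := MvPolynomial.le_totalDegree hsupp

theorem exists_pderiv_ne_zero {R : Type*} [CommRing R] [IsDomain R] [CharZero R]
    {p : MvPolynomial σ R} (hp : ∀ c, p ≠ MvPolynomial.C c) : ∃ i, pderiv i p ≠ 0 := by
  classical
  by_contra! hall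
  refine hp (MvPolynomial.coeff 0 p) (MvPolynomial.ext _ _ fun m => ?_)
  rw [MvPolynomial.coeff_C]
  split_ifs with hm
  · rw [hm]
  · obtain ⟨i, hi⟩ := Finsupp.ne_iff.1 (Ne.symm hm)
    have hcoeff := coeff_pderiv (i := i) p (m - Finsupp.single i 1)
    rw [hall i, MvPolynomial.coeff_zero, tsub_add_cancel_of_le
      (Finsupp.single_le_iff.2 (Nat.one_le_iff_ne_zero.2 hi))] at hcoeff
    exact (mul_eq_zero.1 hcoeff.symm).resolve_right (Nat.cast_add_one_ne_zero _)

/- Induction on the degree: the zeros of `p` at which a chosen non-zero partial derivative of `p`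
vanishes are zeros of that derivative. -/
theorem exists_finset_regular_zeros {R : Type*} [CommRing R] [IsDomain R] [CharZero R]
    (p : MvPolynomial σ R) (hp : p ≠ 0) :
    ∃ s : Finset (MvPolynomial σ R × σ), ∀ x, MvPolynomial.eval x p = 0 →
      ∃ q ∈ s, MvPolynomial.eval x q.1 = 0 ∧ MvPolynomial.eval x (pderiv q.2 q.1) ≠ 0 := by
  classical
  induction hd : p.totalDegree using Nat.strong_induction_on generalizing p with
  | _ d ih =>
    subst hd
    by_cases hconst : ∃ c, p = MvPolynomial.C c
    · obtain ⟨c, rfl⟩ := hconst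
      exact ⟨∅, fun x hx => absurd (by simpa using hx) hp⟩
    · obtain ⟨i, hi⟩ := exists_pderiv_ne_zero (not_exists.1 hconst)
      obtain ⟨s, hs⟩ := ih _ (totalDegree_pderiv_lt hi) _ hi rfl
      refine ⟨insert (p, i) s, fun x hx => ?_⟩
      by_cases hxi : MvPolynomial.eval x (pderiv i p) = 0
      · obtain ⟨q, hq, hreg⟩ := hs x hxi
        exact ⟨q, Finset.mem_insert_of_mem hq, hreg⟩
      · exact ⟨(p, i), Finset.mem_insert_self _ _, hx, hxi⟩

variable {𝕜 : Type*} [NontriviallyNormedField 𝕜]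

theorem hasFDerivAt_eval [Fintype σ] (p : MvPolynomial σ 𝕜) (x : σ → 𝕜) :
    HasFDerivAt (fun y => MvPolynomial.eval y p)
      (∑ i, MvPolynomial.eval x (pderiv i p) •
        (ContinuousLinearMap.proj i : (σ → 𝕜) →L[𝕜] 𝕜)) x := by
  classical
  induction p using MvPolynomial.induction_on with
  | C c =>
    simp only [MvPolynomial.eval_C]
    refine (hasFDerivAt_const (𝕜 := 𝕜) c x).congr_fderiv ?_
    ext v
    simp
  | add p q hp hq =>
    simp only [map_add]
    refine (hp.add hq).congr_fderiv ?_
    ext v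
    simp [add_mul, Finset.sum_add_distrib]
  | mul_X p j hp =>
    have hmul := hp.mul (ContinuousLinearMap.proj (R := 𝕜) (φ := fun _ : σ => 𝕜) j).hasFDerivAt
    simp only [map_mul, MvPolynomial.eval_X]
    refine hmul.congr_fderiv ?_
    ext v
    simp [Pi.single_apply, apply_ite, ite_mul, add_mul, Finset.sum_add_distrib, Finset.mul_sum,
      mul_assoc]

theorem contDiff_eval [Fintype σ] [CompleteSpace 𝕜] (p : MvPolynomial σ 𝕜) (n : WithTop ℕ∞) :
    ContDiff 𝕜 n (fun y : σ → 𝕜 => MvPolynomial.eval y p) :=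
  contDiffOn_univ.1 ((AnalyticOnNhd.eval_mvPolynomial p).contDiffOn_of_completeSpace)

theorem surjective_fderiv_eval [Finite σ] {p : MvPolynomial σ 𝕜} {x : σ → 𝕜} {i : σ}
    (hi : MvPolynomial.eval x (pderiv i p) ≠ 0) :
    Function.Surjective (fderiv 𝕜 (fun y => MvPolynomial.eval y p) x) := by
  classical
  have := Fintype.ofFinite σ
  rw [(hasFDerivAt_eval p x).fderiv]
  intro c
  refine ⟨Pi.single i (c / MvPolynomial.eval x (pderiv i p)), ?_⟩
  simp [Pi.single_apply, mul_div_cancel₀ _ hi]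

end PolynomialZeros

section Rank

variable {K : Type*} [Field K]

theorem rank_lt_card_of_det_eq_zero {n : Type*} [Fintype n] [DecidableEq n] {A : Matrix n n K}
    (hA : A.det = 0) : A.rank < Fintype.card n := by
  refine A.rank_le_card_width.lt_of_ne fun hrank => ?_
  have hli : LinearIndependent K A.col := linearIndependent_iff_card_eq_finrank_span.2
    (by rw [Set.finrank, ← A.rank_eq_finrank_span_cols, hrank])
  have hunit := (A.isUnit_iff_isUnit_det).1 (Matrix.linearIndependent_cols_iff_isUnit.1 hli)
  exact hunit.ne_zero hA

theorem card_le_rank_of_minor_ne_zero {m n ι : Type*} [Finite m] [Fintype n] [Fintype ι]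
    [DecidableEq ι] {A : Matrix m n K} {W : Matrix m ι K}
    (hW : ∀ i, W.col i ∈ Submodule.span K (Set.range A.col)) {r : ι → m}
    (hdet : (W.submatrix r id).det ≠ 0) : Fintype.card ι ≤ A.rank := by
  rw [← Matrix.rank_of_det_ne_zero hdet]
  refine (W.rank_submatrix_le r id).trans ?_
  rw [W.rank_eq_finrank_span_cols, A.rank_eq_finrank_span_cols]
  exact Submodule.finrank_mono (Submodule.span_le.2 (Set.range_subset_iff.2 hW))

end Rank

section HankelRecursion

/-- The `n × n` Hankel matrix of an infinite sequence, of which only the first `2 * n - 1` terms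
occur; the leading sections of a Hankel matrix are Hankel matrices of the same sequence. -/
def hankelMat {R : Type*} (n : ℕ) (g : ℕ → R) : Matrix (Fin n) (Fin n) R :=
  Matrix.of fun j l => g (j.1 + l.1)

@[simp] theorem hankelMat_apply {R : Type*} (n : ℕ) (g : ℕ → R) (j l : Fin n) :
    hankelMat n g j l = g (j.1 + l.1) := rfl

theorem hankelMat_congr {R : Type*} {n : ℕ} {g g' : ℕ → R} (h : ∀ i < 2 * n - 1, g i = g' i) :
    hankelMat n g = hankelMat n g' := by
  ext i j
  exact h _ (by lia)

theorem submatrix_castLE_hankelMat {R : Type*} {n N : ℕ} (hn : n ≤ N) (g : ℕ → R) :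
    (hankelMat N g).submatrix (Fin.castLE hn) (Fin.castLE hn) = hankelMat n g := rfl

/-- The amount by which the sequence `g` fails at the index `j` to satisfy the linear recursion
`g (j + s) + ∑ l, c l * g (j + l) = 0`. -/
def recursionDefect {R : Type*} [CommRing R] {s : ℕ} (g : ℕ → R) (c : Fin s → R) (j : ℕ) : R :=
  g (j + s) + ∑ l : Fin s, c l * g (j + l.1)

/-- The numerators of the coefficients of the recursion of length `s`, the common denominator being
the leading Hankel determinant of order `s` (Cramer's rule). -/
def recursionNum {R : Type*} [CommRing R] (s : ℕ) (g : ℕ → R) : Fin s → R :=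
  (hankelMat s g).adjugate.mulVec fun i => -g (i.1 + s)

theorem recursionNum_congr {R : Type*} [CommRing R] {s : ℕ} {g g' : ℕ → R}
    (h : ∀ i < 2 * s, g i = g' i) : recursionNum s g = recursionNum s g' := by
  have hrhs : (fun i : Fin s => -g (i.1 + s)) = fun i => -g' (i.1 + s) :=
    funext fun i => congrArg Neg.neg (h _ (by lia))
  rw [recursionNum, recursionNum, hankelMat_congr fun i hi => h i (by lia), hrhs]

theorem map_recursionNum {R R' : Type*} [CommRing R] [CommRing R'] (f : R →+* R') (s : ℕ)
    (g : ℕ → R) (l : Fin s) : f (recursionNum s g l) = recursionNum s (f ∘ g) l := by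
  have hadj : (hankelMat s (f ∘ g)).adjugate = (hankelMat s g).adjugate.map f :=
    (f.map_adjugate (hankelMat s g)).symm
  simp [recursionNum, hadj, Matrix.mulVec, dotProduct]

theorem map_det_hankelMat {R R' : Type*} [CommRing R] [CommRing R'] (f : R →+* R') (s : ℕ)
    (g : ℕ → R) : f (hankelMat s g).det = (hankelMat s (f ∘ g)).det :=
  f.map_det _

variable {K : Type*} [Field K]

/-- The coefficients of the recursion of length `s` satisfied by the first terms of `g`; they are
only meaningful if the leading Hankel determinant of order `s` does not vanish. -/
def recursionCoeff (s : ℕ) (g : ℕ → K) : Fin s → K :=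
  (hankelMat s g).det⁻¹ • recursionNum s g

theorem recursionCoeff_congr {s : ℕ} {g g' : ℕ → K} (h : ∀ i < 2 * s, g i = g' i) :
    recursionCoeff s g = recursionCoeff s g' := by
  rw [recursionCoeff, recursionCoeff, recursionNum_congr h,
    hankelMat_congr fun i hi => h i (by lia)]

theorem hankelMat_mulVec_recursionCoeff {s : ℕ} {g : ℕ → K} (hdet : (hankelMat s g).det ≠ 0) :
    (hankelMat s g).mulVec (recursionCoeff s g) = fun i => -g (i.1 + s) := by
  rw [recursionCoeff, Matrix.mulVec_smul, recursionNum, Matrix.mulVec_mulVec,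
    Matrix.mul_adjugate, Matrix.smul_mulVec, Matrix.one_mulVec, inv_smul_smul₀ hdet]

theorem forall_recursionDefect_eq_zero_iff {s : ℕ} {g : ℕ → K} (hdet : (hankelMat s g).det ≠ 0)
    {c : Fin s → K} : (∀ j < s, recursionDefect g c j = 0) ↔ c = recursionCoeff s g := by
  have hinj : Function.Injective (hankelMat s g).mulVec :=
    Matrix.mulVec_injective_of_isUnit ((Matrix.isUnit_iff_isUnit_det _).2 hdet.isUnit)
  rw [← hinj.eq_iff, hankelMat_mulVec_recursionCoeff hdet, funext_iff, Fin.forall_iff]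
  refine forall₂_congr fun j hj => ?_
  simp only [recursionDefect, Matrix.mulVec, dotProduct, hankelMat_apply, mul_comm (g _)]
  exact add_comm (g (j + s)) _ ▸ add_eq_zero_iff_eq_neg

/- Besides the first `s` columns of the matrix, its column space contains the columns of recursion
defects. On suitable rows these `s + t` columns form a block triangular matrix: the upper left
block is the leading section, and the lower right one is triangular with the first non-zero defect
on its diagonal. -/
theorem add_le_rank_hankelMat {n s t m i₀ : ℕ} (g : ℕ → K) (c : Fin s → K)
    (hdet : (hankelMat s g).det ≠ 0) (hzero : ∀ j < m, recursionDefect g c j = 0)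
    (hm : recursionDefect g c m ≠ 0) (hn : i₀ + t + s = n) (hmn : m + 1 = n + i₀) :
    s + t ≤ (hankelMat n g).rank := by
  let W : Matrix (Fin n) (Fin s ⊕ Fin t) K := Matrix.of fun j =>
    Sum.elim (fun i => g (j.1 + i.1)) (fun i => recursionDefect g c (j.1 + i₀ + i.1))
  have hW : ∀ i, W.col i ∈ Submodule.span K (Set.range (hankelMat n g).col) := by
    have hcol : ∀ x : Fin n, (hankelMat n g).col x ∈
        Submodule.span K (Set.range (hankelMat n g).col) := fun x =>
      Submodule.subset_span ⟨x, rfl⟩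
    rintro (i | i)
    · exact hcol ⟨i.1, by lia⟩
    · have hdefect : W.col (Sum.inr i) = (hankelMat n g).col ⟨i₀ + i.1 + s, by lia⟩ +
          ∑ l : Fin s, c l • (hankelMat n g).col ⟨i₀ + i.1 + l.1, by lia⟩ := by
        ext j
        simp [W, recursionDefect, add_assoc]
      rw [hdefect]
      exact add_mem (hcol _) (sum_mem fun l _ => Submodule.smul_mem _ _ (hcol _))
  let r : Fin s ⊕ Fin t → Fin n :=
    Sum.elim (fun j => ⟨j.1, by lia⟩) (fun j => ⟨m - i₀ - j.1, by lia⟩)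
  let U : Matrix (Fin t) (Fin t) K :=
    Matrix.of fun j i => recursionDefect g c (m - i₀ - j.1 + i₀ + i.1)
  have hblocks : W.submatrix r id = Matrix.fromBlocks (hankelMat s g) 0
      (Matrix.of fun (j : Fin t) (i : Fin s) => g (m - i₀ - j.1 + i.1)) U := by
    ext (j | j) (i | i)
    · rfl
    · exact hzero _ (by dsimp only [r, Sum.elim_inl]; lia)
    · rfl
    · rfl
  have hU : U.det = recursionDefect g c m ^ t := by
    have htriangular : U.IsUpperTriangular := fun j i hij =>
      hzero _ (by simp only [id_eq, Fin.lt_def] at hij; lia)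
    rw [Matrix.det_of_isUpperTriangular htriangular]
    simp [U, fun j : Fin t => (by lia : m - i₀ - j.1 + i₀ + j.1 = m)]
  have hminor : (W.submatrix r id).det ≠ 0 := by
    rw [hblocks, Matrix.det_fromBlocks_zero₁₂, hU]
    exact mul_ne_zero hdet (pow_ne_zero _ hm)
  simpa using card_le_rank_of_minor_ne_zero hW hminor

theorem rank_hankelMat_mono {n N : ℕ} (hn : n ≤ N) (g : ℕ → K) :
    (hankelMat n g).rank ≤ (hankelMat N g).rank :=
  (hankelMat N g).rank_submatrix_le (Fin.castLE hn) (Fin.castLE hn)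

/- At a first failure of the recursion, the lower bound for the rank either contradicts the
singularity of a leading section or exceeds `k`. -/
theorem recursionDefect_eq_zero {N s k : ℕ} (hsk : s ≤ k) (g : ℕ → K) (c : Fin s → K)
    (hdet : (hankelMat s g).det ≠ 0) (hsing : ∀ n, s < n → n ≤ k → (hankelMat n g).det = 0)
    (hrank : (hankelMat N g).rank ≤ k) (hc : ∀ j < s, recursionDefect g c j = 0)
    (j : ℕ) (hj : j + k < 2 * N - 1) : recursionDefect g c j = 0 := by
  induction j using Nat.strong_induction_on with
  | _ m ih =>
    by_contra hm
    have hsm : s ≤ m := not_lt.1 fun hlt => hm (hc m hlt)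
    have hbound {n t i₀ : ℕ} (hn : i₀ + t + s = n) (hmn : m + 1 = n + i₀) :
        s + t ≤ (hankelMat n g).rank :=
      add_le_rank_hankelMat g c hdet (fun j hjm => ih j hjm (by lia)) hm hn hmn
    by_cases hmN : m + 1 ≤ N
    · have hfull : s + (m + 1 - s) ≤ (hankelMat (m + 1) g).rank :=
        hbound (i₀ := 0) (by lia) (by lia)
      by_cases hmk : m + 1 ≤ k
      · have hlt := rank_lt_card_of_det_eq_zero (hsing (m + 1) (by lia) hmk)
        rw [Fintype.card_fin] at hlt
        lia
      · have := rank_hankelMat_mono hmN g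
        lia
    · have : s + (2 * N - s - m - 1) ≤ (hankelMat N g).rank :=
        hbound (i₀ := m + 1 - N) (by lia) (by lia)
      lia

theorem rank_hankelMat_le {N k : ℕ} (g : ℕ → K) (c : Fin k → K)
    (h : ∀ j, j + k < 2 * N - 1 → recursionDefect g c j = 0) : (hankelMat N g).rank ≤ k := by
  rcases le_or_gt N k with hNk | hkN
  · exact (hankelMat N g).rank_le_width.trans hNk
  let b : Fin k → (Fin N → K) := fun i => (hankelMat N g).col (Fin.castLE hkN.le i)
  have hspan : ∀ l (hl : l < N), (hankelMat N g).col ⟨l, hl⟩ ∈ Submodule.span K (Set.range b) := by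
    intro l
    induction l using Nat.strong_induction_on with
    | _ l ih =>
      intro hl
      by_cases hlk : l < k
      · exact Submodule.subset_span ⟨⟨l, hlk⟩, rfl⟩
      obtain ⟨i, rfl⟩ := Nat.exists_eq_add_of_le' (not_lt.1 hlk)
      have hrec : (hankelMat N g).col ⟨i + k, hl⟩ =
          -∑ x : Fin k, c x • (hankelMat N g).col ⟨i + x.1, by lia⟩ := by
        ext j
        have hj := h (j.1 + i) (by lia)
        simp only [recursionDefect, add_assoc] at hj
        simpa using eq_neg_of_add_eq_zero_left hj
      rw [hrec]
      exact neg_mem (sum_mem fun x _ => Submodule.smul_mem _ _ (ih _ (by lia) _))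
  have : FiniteDimensional K (Submodule.span K (Set.range b)) :=
    FiniteDimensional.span_of_finite K (Set.finite_range b)
  calc (hankelMat N g).rank ≤ Module.finrank K (Submodule.span K (Set.range b)) := by
        rw [Matrix.rank_eq_finrank_span_cols]
        refine Submodule.finrank_mono (Submodule.span_le.2 (Set.range_subset_iff.2 ?_))
        exact fun l => hspan l.1 l.2
    _ ≤ Fintype.card (Fin k) := finrank_range_le_card b
    _ = k := Fintype.card_fin k

end HankelRecursion

section SmoothMatrices

variable {𝕜 E A n : Type*} [NontriviallyNormedField 𝕜] [NormedAddCommGroup E] [NormedSpace 𝕜 E]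
  [NormedCommRing A] [NormedAlgebra 𝕜 A] [Fintype n] [DecidableEq n] {r : WithTop ℕ∞}

theorem contDiff_det {M : E → Matrix n n A} (hM : ∀ i j, ContDiff 𝕜 r fun x => M x i j) :
    ContDiff 𝕜 r fun x => (M x).det := by
  simp only [Matrix.det_apply]
  exact ContDiff.sum fun σ _ => (contDiff_prod fun i _ => hM _ _).const_smul _

theorem contDiff_adjugate {M : E → Matrix n n A} (hM : ∀ i j, ContDiff 𝕜 r fun x => M x i j)
    (i j : n) : ContDiff 𝕜 r fun x => (M x).adjugate i j := by
  simp only [Matrix.adjugate_apply]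
  refine contDiff_det fun i' j' => ?_
  simp only [Matrix.updateRow_apply]
  split_ifs
  · exact contDiff_const
  · exact hM _ _

end SmoothMatrices

theorem contDiffOn_matrix {E m n R : Type*} [NormedAddCommGroup E] [NormedSpace ℝ E] [Fintype m]
    [Fintype n] [NormedAddCommGroup R] [NormedSpace ℝ R] [FiniteDimensional ℝ R]
    {M : E → Matrix m n R} {O : Set E} {r : WithTop ℕ∞}
    (hM : ∀ i j, ContDiffOn ℝ r (fun x => M x i j) O) : ContDiffOn ℝ r M O := by
  let T : (m → n → R) →L[ℝ] Matrix m n R :=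
    LinearMap.toContinuousLinearMap (Matrix.ofLinearEquiv ℝ).toLinearMap
  exact T.contDiff.comp_contDiffOn (contDiffOn_pi.2 fun i => contDiffOn_pi.2 (hM i))

section Charts

/-- The extension of a finite sequence by zero, so that it can be fed to `hankelMat`. -/
def extendSeq {R : Type*} [Zero R] {n : ℕ} (u : Fin n → R) (m : ℕ) : R :=
  if h : m < n then u ⟨m, h⟩ else 0

theorem hankel_eq_hankelMat {N : ℕ} (f : Fin (2 * N - 1) → ℂ) :
    hankel f = hankelMat N (extendSeq f) := by
  ext j l
  have hjl : j.1 + l.1 < 2 * N - 1 := by lia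
  simp [hankel, extendSeq, hjl]

/-- The sequence generating a Hankel matrix, read off along the path through the first column and
then the last row, which meets each antidiagonal once. -/
def antidiagonalSeq {R : Type*} [Zero R] {N : ℕ} (A : Matrix (Fin N) (Fin N) R) (m : ℕ) : R :=
  if h : m < 2 * N - 1 then A ⟨min m (N - 1), by lia⟩ ⟨m - min m (N - 1), by lia⟩ else 0

theorem antidiagonalSeq_hankelMat {R : Type*} [Zero R] {N : ℕ} (g : ℕ → R) {m : ℕ}
    (hm : m < 2 * N - 1) : antidiagonalSeq (hankelMat N g) m = g m := by
  rw [antidiagonalSeq, dif_pos hm, hankelMat_apply]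
  exact congrArg g (by lia)

theorem hankelMat_antidiagonalSeq {N : ℕ} {A : Matrix (Fin N) (Fin N) ℂ} (hA : A ∈ hankelSet N) :
    hankelMat N (antidiagonalSeq A) = A := by
  ext j l
  rw [hankelMat_apply, antidiagonalSeq, dif_pos (by lia)]
  exact hA _ _ _ _ (by simp only; lia)

theorem hankelMat_mem_hankelSet {N : ℕ} (g : ℕ → ℂ) : hankelMat N g ∈ hankelSet N :=
  fun _ _ _ _ h => congrArg g h

/-- The position in the whole sequence of the `i`-th of the `s + k` coordinates on the stratum of
order `s`: the coordinates are the first `2 * s` and the last `k - s` terms. -/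
def coordIndex (N k s i : ℕ) : ℕ := if i < 2 * s then i else i + (2 * N - 1 - s - k)

/-- The coordinates, in the sense of `coordIndex`, of a Hankel matrix, extended to a linear map on
all matrices. -/
noncomputable def coordMap (N k s : ℕ) :
    Matrix (Fin N) (Fin N) ℂ →L[ℝ] (Fin (s + k) → ℂ) :=
  LinearMap.toContinuousLinearMap
    { toFun := fun A i => antidiagonalSeq A (coordIndex N k s i)
      map_add' := fun A B => by
        ext i
        simp only [antidiagonalSeq, Pi.add_apply]
        split_ifs <;> simp
      map_smul' := fun c A => by
        ext i
        simp only [antidiagonalSeq, Pi.smul_apply]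
        split_ifs <;> simp }

theorem coordMap_hankelMat {N k s : ℕ} (hsk : s ≤ k) (hkN : k < N) (g : ℕ → ℂ)
    (i : Fin (s + k)) : coordMap N k s (hankelMat N g) i = g (coordIndex N k s i) :=
  antidiagonalSeq_hankelMat g (by unfold coordIndex; split_ifs <;> lia)

theorem extendSeq_coordMap_hankelMat {N k s : ℕ} (hsk : s ≤ k) (hkN : k < N) (g : ℕ → ℂ) {m : ℕ}
    (hm : m < s + k) :
    extendSeq (coordMap N k s (hankelMat N g)) m = g (coordIndex N k s m) := by
  rw [extendSeq, dif_pos hm, coordMap_hankelMat hsk hkN]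

/-- The sequence with given coordinates whose other terms are determined by the recursion of length
`s` that its first `2 * s` terms satisfy. -/
def recursionExtension {K : Type*} [Field K] (N k s : ℕ) (u : Fin (s + k) → K) (m : ℕ) : K :=
  if m < 2 * s then extendSeq u m
  else if 2 * N - 1 - (k - s) ≤ m then extendSeq u (m - (2 * N - 1 - s - k))
  else -∑ l : Fin s, recursionCoeff s (extendSeq u) l * recursionExtension N k s u (m - s + l.1)
termination_by m
decreasing_by lia

/-- The Hankel matrix with given coordinates on the stratum of order `s`. -/
def hankelChart {K : Type*} [Field K] (N k s : ℕ) (u : Fin (s + k) → K) :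
    Matrix (Fin N) (Fin N) K :=
  hankelMat N (recursionExtension N k s u)

/-- The coordinates for which the leading section of order `s` is non-singular; elsewhere
`hankelChart` is junk. -/
def chartDomain (k s : ℕ) : Set (Fin (s + k) → ℂ) :=
  {u | (hankelMat s (extendSeq u)).det ≠ 0}

theorem coordMap_hankelChart {N k s : ℕ} (hsk : s ≤ k) (hkN : k < N) (u : Fin (s + k) → ℂ) :
    coordMap N k s (hankelChart N k s u) = u := by
  ext i
  rw [hankelChart, coordMap_hankelMat hsk hkN, recursionExtension, coordIndex]
  by_cases hi : i.1 < 2 * s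
  · simp [hi, extendSeq]
  · have hfirst : ¬ i.1 + (2 * N - 1 - s - k) < 2 * s := by lia
    have hlast : 2 * N - 1 - (k - s) ≤ i.1 + (2 * N - 1 - s - k) := by lia
    simp [hi, hfirst, hlast, extendSeq]

theorem coordMap_surjective {N k s : ℕ} (hsk : s ≤ k) (hkN : k < N) :
    Function.Surjective (coordMap N k s) := fun u => ⟨_, coordMap_hankelChart hsk hkN u⟩

theorem hankelChart_coordMap {N k s : ℕ} (hsk : s ≤ k) (hkN : k < N) {g : ℕ → ℂ}
    (hrec : ∀ j, j + k < 2 * N - 1 → recursionDefect g (recursionCoeff s g) j = 0) :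
    hankelChart N k s (coordMap N k s (hankelMat N g)) = hankelMat N g := by
  have hfirst : ∀ m < 2 * s, extendSeq (coordMap N k s (hankelMat N g)) m = g m := fun m hm => by
    rw [extendSeq_coordMap_hankelMat hsk hkN g (by lia), coordIndex, if_pos hm]
  refine hankelMat_congr fun m => ?_
  induction m using Nat.strong_induction_on with
  | _ m ih =>
    intro hm
    rw [recursionExtension]
    split_ifs with hms hlast
    · exact hfirst m hms
    · rw [extendSeq_coordMap_hankelMat hsk hkN g (by lia), coordIndex, if_neg (by lia)]
      exact congrArg g (by lia)
    · have hdefect := hrec (m - s) (by lia)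
      rw [recursionDefect, Nat.sub_add_cancel (by lia)] at hdefect
      rw [eq_neg_of_add_eq_zero_left hdefect, recursionCoeff_congr hfirst]
      exact congrArg Neg.neg (Finset.sum_congr rfl fun l _ => by rw [ih _ (by lia) (by lia)])

theorem recursionDefect_recursionExtension {N k : ℕ} {u : Fin (k + k) → ℂ}
    (hu : u ∈ chartDomain k k) {j : ℕ} (hj : j + k < 2 * N - 1) :
    recursionDefect (recursionExtension N k k u) (recursionCoeff k (extendSeq u)) j = 0 := by
  have hfirst : ∀ m < 2 * k, recursionExtension N k k u m = extendSeq u m := fun m hm => by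
    rw [recursionExtension, if_pos hm]
  rcases lt_or_ge j k with hjk | hjk
  · rw [← (forall_recursionDefect_eq_zero_iff hu).2 rfl j hjk, recursionDefect, recursionDefect,
      hfirst _ (by lia)]
    exact congrArg _ (Finset.sum_congr rfl fun l _ => by rw [hfirst _ (by lia)])
  · rw [recursionDefect, recursionExtension, if_neg (by lia), if_neg (by lia),
      Nat.add_sub_cancel, neg_add_cancel]

theorem hankelChart_mem {N k : ℕ} {u : Fin (k + k) → ℂ} (hu : u ∈ chartDomain k k) :
    hankelChart N k k u ∈ rankSet N k ∩ hankelSet N :=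
  ⟨rank_hankelMat_le _ _ fun _ => recursionDefect_recursionExtension hu,
    hankelMat_mem_hankelSet _⟩

theorem coordMap_mem_chartDomain_iff {N k s : ℕ} (hsk : s ≤ k) (hkN : k < N) {g : ℕ → ℂ} :
    coordMap N k s (hankelMat N g) ∈ chartDomain k s ↔ (hankelMat s g).det ≠ 0 := by
  rw [chartDomain, Set.mem_ofPred_eq, hankelMat_congr (g' := g) fun m hm => ?_]
  rw [extendSeq_coordMap_hankelMat hsk hkN g (by lia), coordIndex, if_pos (by lia)]

theorem hankelMat_mem_image_chartDomain {N k s : ℕ} (hsk : s ≤ k) (hkN : k < N) {g : ℕ → ℂ}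
    (hdet : (hankelMat s g).det ≠ 0) (hsing : ∀ n, s < n → n ≤ k → (hankelMat n g).det = 0)
    (hrank : (hankelMat N g).rank ≤ k) : hankelMat N g ∈ hankelChart N k s '' chartDomain k s :=
  ⟨coordMap N k s (hankelMat N g), (coordMap_mem_chartDomain_iff hsk hkN).2 hdet,
    hankelChart_coordMap hsk hkN (recursionDefect_eq_zero hsk g _ hdet hsing hrank
      ((forall_recursionDefect_eq_zero_iff hdet).2 rfl))⟩

theorem exists_mem_image_chartDomain {N k : ℕ} (hkN : k < N) {A : Matrix (Fin N) (Fin N) ℂ}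
    (hA : A ∈ rankSet N k ∩ hankelSet N) :
    ∃ s ≤ k, A ∈ hankelChart N k s '' chartDomain k s := by
  classical
  obtain ⟨hrank, hhankel⟩ := hA
  rw [← hankelMat_antidiagonalSeq hhankel] at hrank ⊢
  set g := antidiagonalSeq A
  let s := Nat.findGreatest (fun s => (hankelMat s g).det ≠ 0) k
  have hdet : (hankelMat s g).det ≠ 0 :=
    Nat.findGreatest_spec (P := fun s => (hankelMat s g).det ≠ 0) (Nat.zero_le k) (by simp)
  have hsk : s ≤ k := Nat.findGreatest_le k
  exact ⟨s, hsk, hankelMat_mem_image_chartDomain hsk hkN hdet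
    (fun n hsn hnk => not_not.1 (Nat.findGreatest_is_greatest hsn hnk)) hrank⟩

theorem contDiff_extendSeq {n : ℕ} (m : ℕ) : ContDiff ℝ ∞ fun u : Fin n → ℂ => extendSeq u m := by
  simp only [extendSeq]
  split_ifs
  · exact contDiff_apply ℝ ℂ _
  · exact contDiff_const

theorem contDiff_det_hankelMat_extendSeq {n s : ℕ} :
    ContDiff ℝ ∞ fun u : Fin n → ℂ => (hankelMat s (extendSeq u)).det :=
  contDiff_det fun _ _ => contDiff_extendSeq _

theorem isOpen_chartDomain (k s : ℕ) : IsOpen (chartDomain k s) :=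
  isOpen_ne_fun contDiff_det_hankelMat_extendSeq.continuous continuous_const

theorem contDiffOn_recursionCoeff {k s : ℕ} (l : Fin s) :
    ContDiffOn ℝ ∞ (fun u : Fin (s + k) → ℂ => recursionCoeff s (extendSeq u) l)
      (chartDomain k s) := by
  have hnum : ContDiff ℝ ∞ fun u : Fin (s + k) → ℂ => recursionNum s (extendSeq u) l := by
    simp only [recursionNum, Matrix.mulVec, dotProduct]
    exact ContDiff.sum fun i _ => (contDiff_adjugate (M := fun u => hankelMat s (extendSeq u))
      (fun _ _ => contDiff_extendSeq _) l i).mul (contDiff_extendSeq _).neg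
  exact (contDiff_det_hankelMat_extendSeq.contDiffOn.inv fun _ hu => hu).mul hnum.contDiffOn

theorem contDiffOn_recursionExtension {N k s : ℕ} (m : ℕ) :
    ContDiffOn ℝ ∞ (fun u : Fin (s + k) → ℂ => recursionExtension N k s u m)
      (chartDomain k s) := by
  induction m using Nat.strong_induction_on with
  | _ m ih =>
    simp_rw [recursionExtension.eq_def N k s _ m]
    split_ifs
    · exact (contDiff_extendSeq _).contDiffOn
    · exact (contDiff_extendSeq _).contDiffOn
    · exact (ContDiffOn.sum fun l _ => (contDiffOn_recursionCoeff l).mul (ih _ (by lia))).neg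

theorem contDiffOn_hankelChart {N k s : ℕ} :
    ContDiffOn ℝ ∞ (hankelChart N k s) (chartDomain k s) :=
  contDiffOn_matrix fun _ _ => contDiffOn_recursionExtension _

theorem isSubmanifold_image_hankelChart_zeros {N k s d : ℕ} (hsk : s ≤ k) (hkN : k < N)
    {H : Type*} [NormedAddCommGroup H] [NormedSpace ℝ H] [FiniteDimensional ℝ H]
    {h : (Fin (s + k) → ℂ) → H} {O : Set (Fin (s + k) → ℂ)} (hO : IsOpen O)
    (hdomain : O ⊆ chartDomain k s) (hh : ContDiffOn ℝ ∞ h O)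
    (hreg : ∀ u ∈ O, h u = 0 → Function.Surjective (fderiv ℝ h u))
    (hd : d + Module.finrank ℝ H = 2 * (s + k)) :
    IsSubmanifold d (hankelChart N k s '' {u ∈ O | h u = 0}) := by
  refine isSubmanifold_image_section _ (coordMap_surjective hsk hkN) hO
    (contDiffOn_hankelChart.mono hdomain) (fun u _ => coordMap_hankelChart hsk hkN u) hh hreg ?_
  rw [hd, Module.finrank_pi_fintype]
  simp [Complex.finrank_real_complex, mul_comm]

theorem isSubmanifold_image_hankelChart {N k s : ℕ} (hsk : s ≤ k) (hkN : k < N)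
    {O : Set (Fin (s + k) → ℂ)} (hO : IsOpen O) (hdomain : O ⊆ chartDomain k s) :
    IsSubmanifold (2 * (s + k)) (hankelChart N k s '' O) := by
  simpa using isSubmanifold_image_hankelChart_zeros (N := N) (d := 2 * (s + k))
    (H := Fin 0 → ℝ) (h := 0) hsk hkN hO hdomain contDiffOn_const
    (fun _ _ _ _ => ⟨0, Subsingleton.elim _ _⟩) (by simp)

end Charts

section RecursionPolynomials

variable {R : Type*} [CommRing R] {k : ℕ}

/-- The monic polynomial of degree `k` with the lower coefficients `c`; up to the choice of `c`, the
central polynomial of a Hankel matrix. -/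
noncomputable def monicPoly (c : Fin k → R) : R[X] :=
  X ^ k + ∑ l : Fin k, C (c l) * X ^ l.1

theorem coeff_monicPoly (c : Fin k → R) (l : Fin k) : (monicPoly c).coeff l.1 = c l := by
  simp [monicPoly, coeff_X_pow, l.2.ne, Fin.val_inj]

theorem monic_monicPoly (c : Fin k → R) : (monicPoly c).Monic :=
  monic_X_pow_add (degree_sum_fin_lt c)

theorem natDegree_monicPoly [Nontrivial R] (c : Fin k → R) : (monicPoly c).natDegree = k := by
  rw [monicPoly, natDegree_add_eq_left_of_degree_lt, natDegree_X_pow]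
  exact degree_X_pow (R := R) k ▸ degree_sum_fin_lt c

theorem monicPoly_coeff {P : R[X]} (hP : P.Monic) (hdeg : P.natDegree = k) :
    monicPoly (fun l : Fin k => P.coeff l.1) = P := by
  nth_rewrite 2 [hP.as_sum]
  rw [hdeg, monicPoly, Finset.sum_range]

/-- The multiple of the monic polynomial of the recursion of length `k` by its denominator. Unlike
the monic polynomial, it depends polynomially on the sequence. -/
noncomputable def scaledPoly (k : ℕ) (g : ℕ → R) : R[X] :=
  C (hankelMat k g).det * X ^ k + ∑ l : Fin k, C (recursionNum k g l) * X ^ l.1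

theorem map_scaledPoly {R' : Type*} [CommRing R'] (f : R →+* R') (k : ℕ) (g : ℕ → R) :
    (scaledPoly k g).map f = scaledPoly k (f ∘ g) := by
  simp only [scaledPoly, Polynomial.map_add, Polynomial.map_mul, Polynomial.map_pow, map_X, map_C,
    Polynomial.map_sum]
  simp only [map_det_hankelMat, map_recursionNum]

theorem scaledPoly_eq {K : Type*} [Field K] {g : ℕ → K} (hdet : (hankelMat k g).det ≠ 0) :
    scaledPoly k g = C (hankelMat k g).det * monicPoly (recursionCoeff k g) := by
  have hnum (l : Fin k) : recursionNum k g l = (hankelMat k g).det * recursionCoeff k g l :=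
    (mul_inv_cancel_left₀ hdet _).symm
  simp only [scaledPoly, monicPoly, mul_add, Finset.mul_sum, hnum, C_mul, mul_assoc]

theorem resultant_derivative_ne_zero_iff {K : Type*} [Field K] [IsAlgClosed K] {P : K[X]}
    (hP : P ≠ 0) : resultant P (derivative P) ≠ 0 ↔ P.roots.Nodup := by
  rw [nodup_roots_iff_of_splits hP (IsAlgClosed.splits P), Ne, resultant_eq_zero_iff,
    Polynomial.Separable]
  simp [hP]

end RecursionPolynomials

section Genericity

/-- A polynomial in the coordinates which, on `chartDomain k k`, vanishes exactly where the
polynomial of the recursion has a multiple root or a root at the origin: its constant coefficient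
times its resultant with its derivative. -/
noncomputable def genericityPoly (k : ℕ) : MvPolynomial (Fin (k + k)) ℂ :=
  (scaledPoly k (extendSeq MvPolynomial.X)).coeff 0 *
    resultant (scaledPoly k (extendSeq MvPolynomial.X))
      (derivative (scaledPoly k (extendSeq MvPolynomial.X))) k (k - 1)

theorem eval_genericityPoly {k : ℕ} (u : Fin (k + k) → ℂ) :
    MvPolynomial.eval u (genericityPoly k) = (scaledPoly k (extendSeq u)).coeff 0 *
      resultant (scaledPoly k (extendSeq u)) (derivative (scaledPoly k (extendSeq u))) k
        (k - 1) := by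
  have heval : MvPolynomial.eval u ∘ extendSeq MvPolynomial.X = extendSeq u := by
    ext m
    simp only [Function.comp_apply, extendSeq]
    split_ifs <;> simp
  rw [genericityPoly, map_mul, ← coeff_map, ← resultant_map_map, ← derivative_map,
    map_scaledPoly, heval]

theorem eval_genericityPoly_ne_zero_iff {k : ℕ} {u : Fin (k + k) → ℂ} (hu : u ∈ chartDomain k k) :
    MvPolynomial.eval u (genericityPoly k) ≠ 0 ↔
      ¬ (monicPoly (recursionCoeff k (extendSeq u))).IsRoot 0 ∧
        (monicPoly (recursionCoeff k (extendSeq u))).roots.Nodup := by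
  have hdet : (hankelMat k (extendSeq u)).det ≠ 0 := hu
  set P := monicPoly (recursionCoeff k (extendSeq u))
  have hdeg : P.natDegree = k := natDegree_monicPoly _
  have hresultant : resultant P (derivative P) k (k - 1) ≠ 0 ↔ P.roots.Nodup := by
    rw [← resultant_derivative_ne_zero_iff (monic_monicPoly _).ne_zero, natDegree_derivative, hdeg]
  rw [eval_genericityPoly, scaledPoly_eq hdet, derivative_C_mul, resultant_C_mul_left,
    resultant_C_mul_right, coeff_C_mul, ← hresultant, IsRoot, ← coeff_zero_eq_eval_zero]
  simp [hdet, P]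

section CyclicSequence

/-- The `k`-periodic sequence with period `(0, …, 0, 1)`; the polynomial of its recursion is
`X ^ k - 1`. -/
def cyclicSeq (k m : ℕ) : ℂ := if k ∣ m + 1 then 1 else 0

theorem hankelMat_cyclicSeq (k : ℕ) :
    hankelMat k (cyclicSeq k) = Fin.revPerm.permMatrix ℂ := by
  ext i j
  have hdvd : k ∣ i.1 + j.1 + 1 ↔ Fin.revPerm i = j := by
    rw [Fin.revPerm_apply, Fin.ext_iff, Fin.val_rev]
    constructor
    · rintro ⟨c, hc⟩
      obtain rfl : c = 1 := by
        have : c < 2 := by by_contra! h; nlinarith [i.2, j.2]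
        have : c ≠ 0 := by rintro rfl; simp at hc
        lia
      lia
    · intro h
      exact dvd_of_eq (by lia)
  simp [cyclicSeq, hdvd, PEquiv.toMatrix_apply, eq_comm]

theorem monicPoly_recursionCoeff_cyclicSeq {k : ℕ} (hk : 1 ≤ k) :
    monicPoly (recursionCoeff k (cyclicSeq k)) = X ^ k - 1 := by
  have hdet : (hankelMat k (cyclicSeq k)).det ≠ 0 := by
    simp [hankelMat_cyclicSeq, Matrix.det_permutation]
  have hmonic : (X ^ k - 1 : ℂ[X]).Monic := monic_X_pow_sub_C 1 (by lia)
  have hrec (j : ℕ) (_ : j < k) : recursionDefect (cyclicSeq k)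
      (fun l : Fin k => (X ^ k - 1 : ℂ[X]).coeff l.1) j = 0 := by
    have hperiod : cyclicSeq k (j + k) = cyclicSeq k j := by
      simp [cyclicSeq, add_right_comm j k 1]
    have hcoeff (l : Fin k) :
        (X ^ k - 1 : ℂ[X]).coeff l.1 = if l = ⟨0, hk⟩ then -1 else 0 := by
      simp [coeff_X_pow, coeff_one, l.2.ne, Fin.ext_iff, neg_ite]
    simp [recursionDefect, hperiod, hcoeff]
  rw [← (forall_recursionDefect_eq_zero_iff hdet).1 hrec]
  exact monicPoly_coeff hmonic (natDegree_X_pow_sub_C (r := (1 : ℂ)))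

end CyclicSequence

theorem genericityPoly_ne_zero {k : ℕ} (hk : 1 ≤ k) : genericityPoly k ≠ 0 := by
  let u : Fin (k + k) → ℂ := fun i => cyclicSeq k i.1
  have hext : ∀ m < 2 * k, extendSeq u m = cyclicSeq k m := fun m hm =>
    dif_pos (by lia)
  have hu : u ∈ chartDomain k k := by
    rw [chartDomain, Set.mem_ofPred_eq, hankelMat_congr fun m hm => hext m (by lia),
      hankelMat_cyclicSeq]
    simp [Matrix.det_permutation]
  have heval : MvPolynomial.eval u (genericityPoly k) ≠ 0 := by
    have hk0 : k ≠ 0 := by lia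
    rw [eval_genericityPoly_ne_zero_iff hu, recursionCoeff_congr hext,
      monicPoly_recursionCoeff_cyclicSeq hk]
    exact ⟨by simp [IsRoot, hk0],
      nodup_roots (X_pow_sub_one_separable_iff.2 (Nat.cast_ne_zero.2 hk0))⟩
  exact fun h => heval (by rw [h, map_zero])

end Genericity

section GenericHankelSet

theorem isCentralPolynomial_iff {N k : ℕ} (f : Fin (2 * N - 1) → ℂ) (P : ℂ[X]) :
    IsCentralPolynomial k f P ↔ P.Monic ∧ P.natDegree = k ∧ ∀ j, j + k < 2 * N - 1 →
      recursionDefect (extendSeq f) (fun l : Fin k => P.coeff l.1) j = 0 := by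
  refine and_congr_right fun hmonic => and_congr_right fun hdeg => forall₂_congr fun j hj => ?_
  have hlt (l : Fin (k + 1)) : j + l.1 < 2 * N - 1 := by lia
  have hext (l : Fin (k + 1)) : extendSeq f (j + l.1) = f ⟨j + l.1, hlt l⟩ := dif_pos (hlt l)
  have hlead : P.coeff k = 1 := hdeg ▸ hmonic.coeff_natDegree
  simp [← hext, Fin.sum_univ_castSucc, recursionDefect, hlead, add_comm]

theorem IsCentralPolynomial.eq_monicPoly {N k : ℕ} (hkN : k < N) {f : Fin (2 * N - 1) → ℂ}
    {P : ℂ[X]} (hP : IsCentralPolynomial k f P) (hdet : (hankelMat k (extendSeq f)).det ≠ 0) :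
    P = monicPoly (recursionCoeff k (extendSeq f)) := by
  obtain ⟨hmonic, hdeg, hrec⟩ := (isCentralPolynomial_iff f P).1 hP
  rw [← (forall_recursionDefect_eq_zero_iff hdet).1 fun j hj => hrec j (by lia),
    monicPoly_coeff hmonic hdeg]

theorem isCentralPolynomial_monicPoly {N k : ℕ} {f : Fin (2 * N - 1) → ℂ} {c : Fin k → ℂ}
    (hrec : ∀ j, j + k < 2 * N - 1 → recursionDefect (extendSeq f) c j = 0) :
    IsCentralPolynomial k f (monicPoly c) :=
  (isCentralPolynomial_iff f _).2 ⟨monic_monicPoly c, natDegree_monicPoly c, by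
    simpa only [coeff_monicPoly] using hrec⟩

/-- The coordinates of the generic Hankel matrices. -/
def genericDomain (k : ℕ) : Set (Fin (k + k) → ℂ) :=
  {u | u ∈ chartDomain k k ∧ MvPolynomial.eval u (genericityPoly k) ≠ 0}

theorem isOpen_genericDomain (k : ℕ) : IsOpen (genericDomain k) :=
  (isOpen_chartDomain k k).inter
    (isOpen_ne_fun (contDiff_eval _ 0).continuous continuous_const)

theorem hankelChart_mem_genericHankelSet {N k : ℕ} (hkN : k < N) {u : Fin (k + k) → ℂ}
    (hu : u ∈ genericDomain k) : hankelChart N k k u ∈ genericHankelSet hkN := by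
  obtain ⟨hdomain, heval⟩ := hu
  obtain ⟨hroot, hnodup⟩ := (eval_genericityPoly_ne_zero_iff hdomain).1 heval
  let f : Fin (2 * N - 1) → ℂ := fun i => recursionExtension N k k u i.1
  have hext : ∀ m < 2 * N - 1, extendSeq f m = recursionExtension N k k u m := fun m hm =>
    dif_pos hm
  refine ⟨hankelChart_mem hdomain, ?_, f, _, ?_, isCentralPolynomial_monicPoly fun j hj => ?_,
    hroot, hnodup⟩
  · rw [hankelChart, submatrix_castLE_hankelMat,
      hankelMat_congr (g' := extendSeq u) fun m hm => ?_]
    · exact hdomain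
    · rw [recursionExtension, if_pos (by lia)]
  · rw [hankel_eq_hankelMat, hankelMat_congr hext, hankelChart]
  · rw [← recursionDefect_recursionExtension hdomain hj, recursionDefect, recursionDefect,
      hext _ hj, Finset.sum_congr rfl fun l _ => by rw [hext (j + l.1) (by lia)]]

theorem mem_image_genericDomain {N k : ℕ} {hkN : k < N} {A : Matrix (Fin N) (Fin N) ℂ}
    (hA : A ∈ genericHankelSet hkN) : A ∈ hankelChart N k k '' genericDomain k := by
  obtain ⟨⟨hrank, -⟩, hdet, f, P, rfl, hP, hroot, hnodup⟩ := hA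
  rw [hankel_eq_hankelMat] at hdet hrank ⊢
  rw [submatrix_castLE_hankelMat] at hdet
  obtain ⟨u, hu, hchart⟩ :=
    hankelMat_mem_image_chartDomain le_rfl hkN hdet (fun n _ _ => by lia) hrank
  have hext : ∀ m < 2 * k, extendSeq u m = extendSeq f m := fun m hm => by
    rw [← coordMap_hankelChart le_rfl hkN u, hchart,
      extendSeq_coordMap_hankelMat le_rfl hkN _ (by lia), coordIndex, if_pos hm]
  refine ⟨u, ⟨hu, (eval_genericityPoly_ne_zero_iff hu).2 ?_⟩, hchart⟩
  rw [recursionCoeff_congr hext, ← hP.eq_monicPoly hkN hdet]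
  exact ⟨hroot, hnodup⟩

theorem image_genericDomain {N k : ℕ} (hkN : k < N) :
    hankelChart N k k '' genericDomain k = genericHankelSet hkN :=
  (Set.image_subset_iff.2 fun _ => hankelChart_mem_genericHankelSet hkN).antisymm
    fun _ => mem_image_genericDomain

theorem isThinRelativeTo_of_finite {V ι : Type*} [NormedAddCommGroup V] [NormedSpace ℝ V]
    [FiniteDimensional ℝ V] [Finite ι] {E M : Set V} {D : ℕ} (hM : IsSubmanifold D M)
    {S : ι → Set V} (hS : ∀ i, ∃ d < D, IsSubmanifold d (S i)) (hE : E ⊆ ⋃ i, S i) :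
    IsThinRelativeTo E M := by
  obtain ⟨n, ⟨e⟩⟩ := Finite.exists_equiv_fin ι
  exact ⟨D, hM, n, S ∘ e.symm, fun _ => hS _,
    hE.trans_eq (e.symm.surjective.iUnion_comp S).symm⟩

theorem isSubmanifold_image_hankelChart_eval_eq_zero {N k : ℕ} (hk : 1 ≤ k) (hkN : k < N)
    (q : MvPolynomial (Fin (k + k)) ℂ) (i : Fin (k + k)) :
    IsSubmanifold (2 * (k + k) - 2) (hankelChart N k k ''
      {u ∈ chartDomain k k ∩ {u | MvPolynomial.eval u (MvPolynomial.pderiv i q) ≠ 0} |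
        MvPolynomial.eval u q = 0}) := by
  refine isSubmanifold_image_hankelChart_zeros le_rfl hkN
    ((isOpen_chartDomain k k).inter (isOpen_ne_fun (contDiff_eval _ 0).continuous
      continuous_const)) Set.inter_subset_left
    ((contDiff_eval q ∞).restrict_scalars ℝ).contDiffOn (fun u hu _ => ?_) ?_
  · rw [(hasFDerivAt_eval q u).differentiableAt.fderiv_restrictScalars ℝ]
    exact surjective_fderiv_eval hu.2
  · rw [Complex.finrank_real_complex]
    lia

/- A non-generic matrix of rank at most `k` either lies in a stratum of order less than `k`, or its
coordinates are a zero of `genericityPoly k`, hence a regular zero of one of the finitely many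
polynomials provided by `exists_finset_regular_zeros`. -/
theorem isThinRelativeTo_nongeneric {N k : ℕ} (hk : 1 ≤ k) (hkN : k < N) :
    IsThinRelativeTo ((rankSet N k ∩ hankelSet N) \ genericHankelSet hkN)
      (genericHankelSet hkN) := by
  obtain ⟨t, ht⟩ := exists_finset_regular_zeros _ (genericityPoly_ne_zero hk)
  have hgeneric : IsSubmanifold (2 * (k + k)) (genericHankelSet hkN) :=
    image_genericDomain hkN ▸ isSubmanifold_image_hankelChart le_rfl hkN
      (isOpen_genericDomain k) fun _ hu => hu.1
  refine isThinRelativeTo_of_finite (ι := Fin k ⊕ t) hgeneric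
    (S := Sum.elim (fun s => hankelChart N k s '' chartDomain k s) fun q => hankelChart N k k ''
      {u ∈ chartDomain k k ∩ {u | MvPolynomial.eval u (MvPolynomial.pderiv q.1.2 q.1.1) ≠ 0} |
        MvPolynomial.eval u q.1.1 = 0}) ?_ ?_
  · rintro (s | q)
    · exact ⟨2 * (s + k), by lia, isSubmanifold_image_hankelChart s.2.le hkN
        (isOpen_chartDomain k s) subset_rfl⟩
    · exact ⟨2 * (k + k) - 2, by lia, isSubmanifold_image_hankelChart_eval_eq_zero hk hkN _ _⟩
  · rintro A ⟨hA, hnongeneric⟩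
    obtain ⟨s, hsk, hstratum⟩ := exists_mem_image_chartDomain hkN hA
    rcases hsk.lt_or_eq with hlt | rfl
    · exact Set.mem_iUnion.2 ⟨Sum.inl ⟨s, hlt⟩, hstratum⟩
    · obtain ⟨u, hu, rfl⟩ := hstratum
      have heval : MvPolynomial.eval u (genericityPoly s) = 0 := by
        by_contra heval
        exact hnongeneric (hankelChart_mem_genericHankelSet hkN ⟨hu, heval⟩)
      obtain ⟨q, hq, hzero, hregular⟩ := ht u heval
      exact Set.mem_iUnion.2 ⟨Sum.inr ⟨q, hq⟩, u, ⟨⟨hu, hregular⟩, hzero⟩, rfl⟩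

end GenericHankelSet

section Skeleton

variable {m n ι : Type*} [Fintype ι] [DecidableEq ι] {r : ι → m} {c : ι → n}

/-- The skeleton (cross) decomposition of a matrix built from the columns `c`, the rows `r` and the
submatrix in which they meet. It is a smooth retraction onto the matrices of rank at most
`Fintype.card ι`, near those for which that submatrix is non-singular. -/
noncomputable def skeleton {K : Type*} [Field K] (r : ι → m) (c : ι → n) (M : Matrix m n K) :
    Matrix m n K :=
  M.submatrix id c * (M.submatrix r c)⁻¹ * M.submatrix r id

theorem rank_skeleton_le {K : Type*} [Field K] [Fintype n] (M : Matrix m n K) :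
    (skeleton r c M).rank ≤ Fintype.card ι :=
  (Matrix.rank_mul_le_right _ _).trans (Matrix.rank_le_card_height _)

/- Bordering the non-singular block by one row and one column gives a singular matrix, whose Schur
complement is the difference of the two entries. -/
theorem skeleton_eq_self {K : Type*} [Field K] [Fintype n] {M : Matrix m n K}
    (hrank : M.rank ≤ Fintype.card ι) (hdet : (M.submatrix r c).det ≠ 0) :
    skeleton r c M = M := by
  ext j l
  let B : Matrix (ι ⊕ Unit) (ι ⊕ Unit) K :=
    M.submatrix (Sum.elim r fun _ => j) (Sum.elim c fun _ => l)
  have hB : B.det = 0 := by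
    by_contra hne
    have hle := (Matrix.rank_of_det_ne_zero hne).symm.trans_le (M.rank_submatrix_le _ _)
    rw [Fintype.card_sum, Fintype.card_unit] at hle
    lia
  have hblocks : B = Matrix.fromBlocks (M.submatrix r c) (M.submatrix r fun _ => l)
      (M.submatrix (fun _ => j) c) (M.submatrix (fun _ => j) fun _ => l) :=
    (Matrix.fromBlocks_toBlocks B).symm
  let := Matrix.invertibleOfIsUnitDet _ hdet.isUnit
  rw [hblocks, Matrix.det_fromBlocks₁₁, mul_eq_zero, or_iff_right hdet, Matrix.det_unique,
    Matrix.sub_apply, sub_eq_zero, Matrix.invOf_eq_nonsing_inv] at hB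
  exact hB.symm

theorem skeleton_apply_congr {K : Type*} [Field K] {A B : Matrix m n K} {j : m} {l : n}
    (hblock : ∀ i i', A (r i) (c i') = B (r i) (c i')) (hrow : ∀ i, A j (c i) = B j (c i))
    (hcol : ∀ i, A (r i) l = B (r i) l) : skeleton r c A j l = skeleton r c B j l := by
  have hsub : A.submatrix r c = B.submatrix r c := Matrix.ext hblock
  simp only [skeleton, hsub, Matrix.mul_apply, Matrix.submatrix_apply, id_eq, hrow, hcol]

theorem isOpen_det_submatrix_ne_zero (r : ι → m) (c : ι → n) :
    IsOpen {M : Matrix m n ℂ | (M.submatrix r c).det ≠ 0} :=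
  isOpen_ne_fun (continuous_id.matrix_submatrix r c).matrix_det continuous_const

section Smoothness

variable [Fintype m] [Fintype n]

/-- The entry of a complex matrix, as a continuous real-linear map. -/
noncomputable def entryCLM (j : m) (l : n) : Matrix m n ℂ →L[ℝ] ℂ :=
  LinearMap.toContinuousLinearMap (Matrix.entryLinearMap ℝ ℂ j l)

theorem contDiff_entry (j : m) (l : n) : ContDiff ℝ ∞ fun M : Matrix m n ℂ => M j l :=
  (entryCLM j l).contDiff

theorem contDiffOn_skeleton :
    ContDiffOn ℝ ∞ (skeleton r c) {M : Matrix m n ℂ | (M.submatrix r c).det ≠ 0} := by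
  refine contDiffOn_matrix fun j l => ?_
  simp only [skeleton, Matrix.mul_apply, Matrix.inv_def, Ring.inverse_eq_inv', Matrix.smul_apply,
    smul_eq_mul, Matrix.submatrix_apply, id]
  have hdet : ContDiff ℝ ∞ fun M : Matrix m n ℂ => (M.submatrix r c).det :=
    contDiff_det fun _ _ => contDiff_entry _ _
  have hadj (i i' : ι) : ContDiff ℝ ∞ fun M : Matrix m n ℂ => (M.submatrix r c).adjugate i i' :=
    contDiff_adjugate (fun _ _ => contDiff_entry _ _) i i'
  exact ContDiffOn.sum fun i _ => (ContDiffOn.sum fun i' _ => (contDiff_entry _ _).contDiffOn.mul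
    ((hdet.contDiffOn.inv fun _ hM => hM).mul (hadj i' i).contDiffOn)).mul
      (contDiff_entry _ _).contDiffOn

theorem isLocalRetraction_skeleton {A : Matrix m n ℂ} (hdet : (A.submatrix r c).det ≠ 0) :
    IsLocalRetraction (skeleton r c) {M : Matrix m n ℂ | M.rank ≤ Fintype.card ι} A := by
  have hnhds := (isOpen_det_submatrix_ne_zero r c).mem_nhds hdet
  refine ⟨contDiffAt_infty.1 (contDiffOn_skeleton.contDiffAt hnhds) 2,
    Eventually.of_forall rank_skeleton_le, ?_⟩
  filter_upwards [hnhds] with M hM hrank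
  exact skeleton_eq_self hrank hM

end Smoothness

/- Moving in the direction `H` changes neither the block nor the row and the column that enter the
formula for the entry. -/
theorem fderiv_skeleton_apply_eq_zero [Finite m] [Finite n] {A H : Matrix m n ℂ}
    (hdet : (A.submatrix r c).det ≠ 0) {j : m} {l : n} (hblock : ∀ i i', H (r i) (c i') = 0)
    (hrow : ∀ i, H j (c i) = 0) (hcol : ∀ i, H (r i) l = 0) :
    fderiv ℝ (skeleton r c) A H j l = 0 := by
  have := Fintype.ofFinite m
  have := Fintype.ofFinite n
  have hline : HasLineDerivAt ℝ (fun M => skeleton r c M j l) _ A H :=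
    ((entryCLM j l).hasFDerivAt.comp A
      (isLocalRetraction_skeleton hdet).hasFDerivAt).hasLineDerivAt H
  have hconst (t : ℝ) : skeleton r c (A + t • H) j l = skeleton r c A j l :=
    skeleton_apply_congr (by simp [hblock]) (by simp [hrow]) (by simp [hcol])
  simp only [HasLineDerivAt, hconst] at hline
  exact hline.unique (hasDerivAt_const _ _)

end Skeleton

section CleanIntersection

theorem isClosed_rankSet (N k : ℕ) : IsClosed (rankSet N k) := by
  let T : Matrix (Fin N) (Fin N) ℂ →ₗ[ℂ] ((Fin N → ℂ) →L[ℂ] (Fin N → ℂ)) :=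
    LinearMap.toContinuousLinearMap.toLinearMap ∘ₗ Matrix.toLin'.toLinearMap
  have hopen := (isOpen_setOfPred_nat_le_rank (𝕜 := ℂ) (E := Fin N → ℂ) (F := Fin N → ℂ)
    (k + 1)).preimage T.continuous_of_finiteDimensional
  rw [← isOpen_compl_iff]
  convert hopen using 1
  ext A
  have hrank : (((T A : (Fin N → ℂ) →L[ℂ] (Fin N → ℂ)) : (Fin N → ℂ) →ₗ[ℂ] (Fin N → ℂ))).rank =
      (A.rank : Cardinal) := by
    rw [LinearMap.rank, ← Module.finrank_eq_rank]
    rfl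
  simp only [rankSet, Set.mem_compl_iff, Set.mem_ofPred_eq, not_le, Set.mem_preimage, hrank,
    Nat.cast_le, Nat.lt_iff_add_one_le]

/-- The Hankel matrices, as a real vector space. -/
def hankelSubmodule (N : ℕ) : Submodule ℝ (Matrix (Fin N) (Fin N) ℂ) where
  carrier := hankelSet N
  add_mem' hA hB j l j' l' h := congrArg₂ (· + ·) (hA j l j' l' h) (hB j l j' l' h)
  zero_mem' _ _ _ _ _ := rfl
  smul_mem' t _ hA j l j' l' h := congrArg (t • ·) (hA j l j' l' h)

variable {N k : ℕ}

theorem hankelChart_coordMap_of_mem (hkN : k < N) {A : Matrix (Fin N) (Fin N) ℂ}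
    (hA : A ∈ rankSet N k ∩ hankelSet N) (hdomain : coordMap N k k A ∈ chartDomain k k) :
    hankelChart N k k (coordMap N k k A) = A := by
  obtain ⟨hrank, hhankel⟩ := hA
  rw [← hankelMat_antidiagonalSeq hhankel] at hrank hdomain ⊢
  obtain ⟨u, -, hu⟩ := hankelMat_mem_image_chartDomain le_rfl hkN
    ((coordMap_mem_chartDomain_iff le_rfl hkN).1 hdomain) (fun n _ _ => by lia) hrank
  rw [← hu, coordMap_hankelChart le_rfl hkN]

theorem isLocalRetraction_hankelChart (hkN : k < N) {u : Fin (k + k) → ℂ}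
    (hu : u ∈ chartDomain k k) :
    IsLocalRetraction (hankelChart N k k ∘ coordMap N k k) (rankSet N k ∩ hankelSet N)
      (hankelChart N k k u) := by
  rw [← coordMap_hankelChart (N := N) le_rfl hkN u] at hu
  have hnhds : ∀ᶠ M in 𝓝 (hankelChart N k k u), coordMap N k k M ∈ chartDomain k k :=
    (coordMap N k k).continuous.continuousAt.eventually ((isOpen_chartDomain k k).mem_nhds hu)
  refine ⟨?_, hnhds.mono fun M hM => hankelChart_mem hM,
    hnhds.mono fun M hM hMS => hankelChart_coordMap_of_mem hkN hMS hM⟩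
  exact contDiffAt_infty.1 ((contDiffOn_hankelChart.contDiffAt
    ((isOpen_chartDomain k k).mem_nhds hu)).comp _ (coordMap N k k).contDiff.contDiffAt) 2

theorem det_submatrix_hankelChart_ne_zero (hkN : k < N) {u : Fin (k + k) → ℂ}
    (hu : u ∈ chartDomain k k) :
    ((hankelChart N k k u).submatrix (Fin.castLE hkN.le) (Fin.castLE hkN.le)).det ≠ 0 := by
  rw [← coordMap_hankelChart (N := N) le_rfl hkN u] at hu
  exact (coordMap_mem_chartDomain_iff le_rfl hkN).1 hu

theorem isLocalRetraction_leadingSkeleton (hkN : k < N) {A : Matrix (Fin N) (Fin N) ℂ}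
    (hdet : (A.submatrix (Fin.castLE hkN.le) (Fin.castLE hkN.le)).det ≠ 0) :
    IsLocalRetraction (skeleton (Fin.castLE hkN.le) (Fin.castLE hkN.le)) (rankSet N k) A := by
  simpa only [rankSet, Fintype.card_fin] using isLocalRetraction_skeleton hdet

/- The derivative of the skeleton decomposition determines an entry of the trailing block from
entries on smaller antidiagonals, so the vanishing propagates from the coordinates to all of `H`. -/
theorem eq_zero_of_fderiv_skeleton_eq_self (hkN : k < N) {A H : Matrix (Fin N) (Fin N) ℂ}
    (hdet : (A.submatrix (Fin.castLE hkN.le) (Fin.castLE hkN.le)).det ≠ 0)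
    (hH : H ∈ hankelSubmodule N)
    (hfix : fderiv ℝ (skeleton (Fin.castLE hkN.le) (Fin.castLE hkN.le)) A H = H)
    (hcoord : coordMap N k k H = 0) : H = 0 := by
  obtain ⟨g, rfl⟩ : ∃ g, hankelMat N g = H := ⟨_, hankelMat_antidiagonalSeq hH⟩
  suffices hzero : ∀ m < 2 * N - 1, g m = 0 from Matrix.ext fun j l => hzero _ (by lia)
  intro m
  induction m using Nat.strong_induction_on with
  | _ m ih =>
    intro hm
    by_cases hmk : m < 2 * k
    · have hcoordinate := extendSeq_coordMap_hankelMat le_rfl hkN g (m := m) (by lia)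
      rw [hcoord, coordIndex, if_pos hmk] at hcoordinate
      simp [← hcoordinate, extendSeq]
    · let j : Fin N := ⟨min (m - k) (N - 1), by lia⟩
      let l : Fin N := ⟨m - min (m - k) (N - 1), by lia⟩
      have hentry : hankelMat N g j l = 0 := by
        rw [← hfix]
        refine fderiv_skeleton_apply_eq_zero hdet (fun i i' => ih _ ?_ ?_) (fun i => ih _ ?_ ?_)
          (fun i => ih _ ?_ ?_) <;> simp only [Fin.val_castLE, j, l] <;> lia
      have hjl : j.1 + l.1 = m := by simp only [j, l]; lia
      rwa [hankelMat_apply, hjl] at hentry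

theorem retractionTangent_inf_hankelSubmodule_le (hkN : k < N) {u : Fin (k + k) → ℂ}
    (hu : u ∈ chartDomain k k) :
    retractionTangent (skeleton (Fin.castLE hkN.le) (Fin.castLE hkN.le)) (hankelChart N k k u) ⊓
        hankelSubmodule N ≤
      retractionTangent (hankelChart N k k ∘ coordMap N k k) (hankelChart N k k u) := by
  rintro H ⟨hHR, hHL⟩
  have hdet := det_submatrix_hankelChart_ne_zero hkN hu
  have hR := isLocalRetraction_leadingSkeleton hkN hdet
  have hS := isLocalRetraction_hankelChart hkN hu
  have hmem := hankelChart_mem (N := N) hu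
  set H' := fderiv ℝ (hankelChart N k k ∘ coordMap N k k) (hankelChart N k k u) H
  have hH'S : H' ∈ retractionTangent (hankelChart N k k ∘ coordMap N k k)
      (hankelChart N k k u) := ⟨H, rfl⟩
  have hH'R := hS.tangent_mono hR hmem Set.inter_subset_left hH'S
  have hH'L : H' ∈ hankelSubmodule N := hS.tangent_le_submodule hmem
    (.of_finiteDimensional _) Set.inter_subset_right hH'S
  have hcoord : coordMap N k k H' = coordMap N k k H := by
    have hcomp : coordMap N k k ∘ hankelChart N k k ∘ coordMap N k k = coordMap N k k :=
      funext fun M => coordMap_hankelChart le_rfl hkN _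
    have hderiv := (coordMap N k k).hasFDerivAt.comp _ hS.hasFDerivAt
    rw [hcomp] at hderiv
    exact DFunLike.congr_fun (hderiv.unique (coordMap N k k).hasFDerivAt) H
  have hsub : H - H' = 0 := by
    refine eq_zero_of_fderiv_skeleton_eq_self hkN hdet (sub_mem hHL hH'L) ?_ ?_
    · exact (hR.mem_tangent_iff hmem.1).1 (sub_mem hHR hH'R)
    · rw [map_sub, hcoord, sub_self]
  exact sub_eq_zero.1 hsub ▸ hH'S

end CleanIntersection

section WeightedProjections

variable {N k : ℕ}

theorem hankel_mem_hankelSet (f : Fin (2 * N - 1) → ℂ) : hankel f ∈ hankelSet N :=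
  hankel_eq_hankelMat f ▸ hankelMat_mem_hankelSet _

theorem exists_hankel_eq {A : Matrix (Fin N) (Fin N) ℂ} (hA : A ∈ hankelSet N) :
    ∃ f, hankel f = A :=
  ⟨fun m => antidiagonalSeq A m, hankelMat_antidiagonalSeq hA⟩

theorem mem_genericHankelSet_of_coordMap_mem (hkN : k < N) {A : Matrix (Fin N) (Fin N) ℂ}
    (hA : A ∈ rankSet N k ∩ hankelSet N) (hdomain : coordMap N k k A ∈ genericDomain k) :
    A ∈ genericHankelSet hkN :=
  hankelChart_coordMap_of_mem hkN hA hdomain.1 ▸ hankelChart_mem_genericHankelSet hkN hdomain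

theorem eventually_alternatingProjections_hankel (hkN : k < N) {E : Type*}
    [NormedAddCommGroup E] [InnerProductSpace ℝ E] (e : Matrix (Fin N) (Fin N) ℂ ≃L[ℝ] E)
    {A : Matrix (Fin N) (Fin N) ℂ} (hA : A ∈ genericHankelSet hkN) {ε : ℝ} (hε : 0 < ε) :
    ∀ᶠ b in 𝓝 (e A), e.symm b ∈ hankelSet N → ∃ (B : ℕ → E) (p x : E),
      IsAlternatingNearestSeq (e.symm ⁻¹' rankSet N k) (e.symm ⁻¹' hankelSet N) b B ∧
      IsUniqueNearest (e.symm ⁻¹' (rankSet N k ∩ hankelSet N)) b p ∧ Tendsto B atTop (𝓝 x) ∧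
      e.symm x ∈ genericHankelSet hkN ∧ ‖x - p‖ ≤ ε * ‖b - p‖ := by
  rw [← image_genericDomain hkN] at hA
  obtain ⟨u, hu, rfl⟩ := hA
  have := e.toLinearEquiv.finiteDimensional
  have hmem := hankelChart_mem (N := N) hu.1
  have hR := isLocalRetraction_leadingSkeleton hkN (det_submatrix_hankelChart_ne_zero hkN hu.1)
  have hS := isLocalRetraction_hankelChart hkN hu.1
  have hclean := retractionTangent_inf_hankelSubmodule_le hkN hu.1
  have hW : coordMap N k k ⁻¹' genericDomain k ∈ 𝓝 (hankelChart N k k u) :=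
    (coordMap N k k).continuous.continuousAt.preimage_mem_nhds ((isOpen_genericDomain k).mem_nhds
      (by rwa [coordMap_hankelChart le_rfl hkN]))
  filter_upwards [eventually_alternatingProjections_preimage e (isClosed_rankSet N k) hmem.1
    (L := hankelSubmodule N) hmem.2 hR hS hclean hε hW] with b hb hbL
  obtain ⟨B, p, x, hB, hp, hx, hxS, hxW, hxp⟩ := hb hbL
  exact ⟨B, p, x, hB, hp, hx, mem_genericHankelSet_of_coordMap_mem hkN hxS hxW, hxp⟩

variable {w : Fin N → ℝ}

/-- The rescaling of the entries which turns the weighted Frobenius norm into the Euclidean one. -/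
noncomputable def weightEquiv (hw : ∀ j, 0 < w j) :
    Matrix (Fin N) (Fin N) ℂ ≃L[ℝ] EuclideanSpace ℂ (Fin N × Fin N) :=
  LinearEquiv.toContinuousLinearEquiv
    { toFun A := WithLp.toLp 2 fun p => √(w p.1 * w p.2) • A p.1 p.2
      invFun x := Matrix.of fun j l => (√(w j * w l))⁻¹ • x (j, l)
      map_add' A B := by ext p; simp
      map_smul' c A := by ext p; simp [mul_left_comm]
      left_inv A := Matrix.ext fun j l =>
        inv_smul_smul₀ (Real.sqrt_pos.2 (mul_pos (hw j) (hw l))).ne' (A j l)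
      right_inv x := PiLp.ext fun p =>
        smul_inv_smul₀ (Real.sqrt_pos.2 (mul_pos (hw p.1) (hw p.2))).ne' (x p) }

theorem norm_weightEquiv (hw : ∀ j, 0 < w j) (A : Matrix (Fin N) (Fin N) ℂ) :
    ‖weightEquiv hw A‖ = weightedNorm w A := by
  rw [EuclideanSpace.norm_eq, weightedNorm, Fintype.sum_prod_type]
  refine congrArg Real.sqrt (Finset.sum_congr rfl fun j _ => Finset.sum_congr rfl fun l _ => ?_)
  change ‖√(w j * w l) • A j l‖ ^ 2 = _
  rw [norm_smul, mul_pow, Real.norm_eq_abs, sq_abs, Real.sq_sqrt (mul_pos (hw j) (hw l)).le]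
  ring

theorem weightedNorm_weightEquiv_symm_sub (hw : ∀ j, 0 < w j)
    (x y : EuclideanSpace ℂ (Fin N × Fin N)) :
    weightedNorm w ((weightEquiv hw).symm x - (weightEquiv hw).symm y) = ‖x - y‖ := by
  rw [← norm_weightEquiv hw, ← map_sub, ContinuousLinearEquiv.apply_symm_apply]

theorem IsUniqueNearest.isProjection (hw : ∀ j, 0 < w j) {S : Set (Matrix (Fin N) (Fin N) ℂ)}
    {b p : EuclideanSpace ℂ (Fin N × Fin N)}
    (h : IsUniqueNearest ((weightEquiv hw).symm ⁻¹' S) b p) :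
    IsProjection w S ((weightEquiv hw).symm b) ((weightEquiv hw).symm p) := by
  refine ⟨h.1, (weightEquiv hw).symm.surjective.forall.2 fun q hq hne => ?_⟩
  simp only [weightedNorm_weightEquiv_symm_sub]
  exact h.2 q hq (ne_of_apply_ne _ hne)

theorem exists_alternatingProjections_of_mem_genericHankelSet (hw : ∀ j, 0 < w j) (hkN : k < N)
    {A : Matrix (Fin N) (Fin N) ℂ} (hA : A ∈ genericHankelSet hkN) {ε : ℝ} (hε : 0 < ε) :
    ∃ s > 0, ∀ H ∈ hankelSet N, weightedNorm w (H - A) ≤ s →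
      ∃ (B : ℕ → Matrix (Fin N) (Fin N) ℂ) (P X : Matrix (Fin N) (Fin N) ℂ),
        IsAlternatingProjectionSeq w k H B ∧
        IsProjection w (rankSet N k ∩ hankelSet N) H P ∧
        Tendsto (fun j => weightedNorm w (B j - X)) atTop (𝓝 0) ∧
        X ∈ genericHankelSet hkN ∧ weightedNorm w (X - P) ≤ ε * weightedNorm w (H - P) := by
  let e := weightEquiv hw
  obtain ⟨s, hs, hball⟩ := Metric.nhds_basis_closedBall.eventually_iff.1
    (eventually_alternatingProjections_hankel hkN e hA hε)
  refine ⟨s, hs, e.symm.surjective.forall.2 fun b hb hbA => ?_⟩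
  have hdist : b ∈ Metric.closedBall (e A) s := by
    rwa [mem_closedBall_iff_norm, ← weightedNorm_weightEquiv_symm_sub hw,
      ContinuousLinearEquiv.symm_apply_apply]
  obtain ⟨B, p, x, hB, hp, hx, hxgen, hxp⟩ := hball hdist hb
  refine ⟨fun j => e.symm (B j), e.symm p, e.symm x, ⟨congrArg e.symm hB.1, fun j =>
    ⟨fun hj => ((hB.2 j).1 hj).isProjection hw, fun hj => ((hB.2 j).2 hj).isProjection hw⟩⟩,
    hp.isProjection hw, ?_, hxgen, ?_⟩
  · simpa only [e, weightedNorm_weightEquiv_symm_sub] using tendsto_iff_norm_sub_tendsto_zero.1 hx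
  · simpa only [e, weightedNorm_weightEquiv_symm_sub] using hxp

end WeightedProjections

theorem theorem7 (N k : ℕ) (hk : 1 ≤ k) (hkN : k < N) (w : Fin N → ℝ) (hw : ∀ j, 0 < w j) :
    ∃ T : Set (Matrix (Fin N) (Fin N) ℂ),
      T ⊆ rankSet N k ∩ hankelSet N ∧
      IsThinRelativeTo T (genericHankelSet hkN) ∧
      ∀ A ∈ rankSet N k ∩ hankelSet N, A ∉ T →
        ∀ ε : ℝ, 0 < ε → ∃ s : ℝ, 0 < s ∧
          ∀ f : Fin (2 * N - 1) → ℂ, weightedNorm w (hankel f - A) ≤ s →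
            ∃ (B : ℕ → Matrix (Fin N) (Fin N) ℂ) (fopt finf : Fin (2 * N - 1) → ℂ),
              IsAlternatingProjectionSeq w k (hankel f) B ∧
              IsProjection w (rankSet N k ∩ hankelSet N) (hankel f) (hankel fopt) ∧
              Tendsto (fun j => weightedNorm w (B j - hankel finf)) atTop (𝓝 0) ∧
              hankel finf ∈ genericHankelSet hkN ∧
              weightedNorm w (hankel finf - hankel fopt) ≤
                ε * weightedNorm w (hankel f - hankel fopt) := by
  refine ⟨_, Set.sdiff_subset, isThinRelativeTo_nongeneric hk hkN, fun A hA hAT ε hε => ?_⟩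
  have hgeneric : A ∈ genericHankelSet hkN := not_not.1 fun h => hAT ⟨hA, h⟩
  obtain ⟨s, hs, hproj⟩ := exists_alternatingProjections_of_mem_genericHankelSet hw hkN hgeneric hε
  refine ⟨s, hs, fun f hf => ?_⟩
  obtain ⟨B, P, X, hB, hP, hX, hXgeneric, hle⟩ := hproj _ (hankel_mem_hankelSet f) hf
  obtain ⟨fopt, rfl⟩ := exists_hankel_eq hP.1.2
  obtain ⟨finf, rfl⟩ := exists_hankel_eq hXgeneric.1.2
  exact ⟨B, fopt, finf, hB, hP, hX, hXgeneric, hle⟩
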